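/- Let $m,n\ge 0$ be integers. For $N\ge 0$ let $H_N(0)$ be the $0$-Hecke algebra, i.e. the unital associative $\mathbb C$-algebra generated by $\bar\pi_1,\dots,\bar\pi_{N-1}$ with relations $\bar\pi_i^2=-\bar\pi_i$, $\bar\pi_i\bar\pi_{i+1}\bar\pi_i=\bar\pi_{i+1}\bar\pi_i\bar\pi_{i+1}$ and $\bar\pi_i\bar\pi_j=\bar\pi_j\bar\pi_i$ for $|i-j|\ge 2$; put $\pi_i=\bar\pi_i+1$. View $H_m(0)\otimes H_n(0)$ as the subalgebra of $H_{m+n}(0)$ generated by the $\bar\pi_i$ with $i\ne m$. All modules are right modules; write $\uparrow$ and $\downarrow$ for induction and restriction between $H_m(0)\otimes H_n(0)$ and $H_{m+n}(0)$, and let $M\boxtimes N=(M\otimes N)\uparrow_{H_m(0)\otimes H_n(0)}^{H_{m+n}(0)}$ for an $H_m(0)$-module $M$ and an $H_n(0)$-module $N$. Twists. Let $\phi,\theta$ be the automorphisms of $H_N(0)$ with $\phi(\bar\pi_i)=\bar\pi_{N-i}$ and $\theta(\bar\pi_i)=-\pi_i$, and let $\chi$ be the anti-automorphism with $\chi(\bar\pi_i)=\bar\pi_i$.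 For $\mu\in\{\phi,\theta\}$ the module $\mu[M]$ is the space $M$ with action $v\cdot_\mu h=v\cdot\mu(h)$; the module $\chi[M]$ is the dual space $M^*$ with action $(\delta\cdot^\chi h)(v)=\delta(v\cdot\chi(h))$. With $N=m+n$, the restriction of $\phi$ is an isomorphism from $H_m(0)\otimes H_n(0)$ onto $H_n(0)\otimes H_m(0)$, while $\theta$ and $\chi$ restrict to an automorphism and an anti-automorphism of $H_m(0)\otimes H_n(0)$; twists of modules over these subalgebras are formed with the restricted maps, so that $\phi$ twists an $H_n(0)\otimes H_m(0)$-module into an $H_m(0)\otimes H_n(0)$-module. Poset modules. Let $P$ be a partial order on $[N]=\{1,\dots,N\}$, and let $\Sigma_R(P)\subseteq\mathfrak S_N$ be the set of permutations $\gamma$ whose one-line notation $\gamma(1)\cdots\gamma(N)$ lists $[N]$ in increasing order with respect to some linear extension of $P$. Let $s_i=(i\ \,i+1)$, let $\ell$ be the length function of $\mathfrak S_N$, and let $\mathrm{Des}_R(\gamma)=\{i:\ell(\gamma s_i)<\ell(\gamma)\}$. The module $M_P$ is $\mathbb C\,\Sigma_R(P)$ with $\gamma\cdot\bar\pi_i=-\gamma$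 if $i\in\mathrm{Des}_R(\gamma)$, $\gamma\cdot\bar\pi_i=0$ if $i\notin\mathrm{Des}_R(\gamma)$ and $\gamma s_i\notin\Sigma_R(P)$, and $\gamma\cdot\bar\pi_i=\gamma s_i$ if $i\notin\mathrm{Des}_R(\gamma)$ and $\gamma s_i\in\Sigma_R(P)$. The module $M'_P$ is $\mathbb C\,\Sigma_R(P)$ with $\gamma\cdot\pi_i=\gamma$, $0$, $\gamma s_i$ in the same three cases. Let $\overline P$ be the partial order with $u\preceq_{\overline P}v\iff N+1-u\preceq_P N+1-v$, and $P^*$ the one with $u\preceq_{P^*}v\iff v\preceq_P u$. **Corollary.** (a) Let $P_1$ and $P_2$ be partial orders on $[m]$ and $[n]$. As $H_{m+n}(0)$-modules, $$\phi[M_{P_1}\boxtimes M_{P_2}]\cong M_{\overline{P_2}^*}\boxtimes M_{\overline{P_1}^*},\qquad \theta[M_{P_1}\boxtimes M_{P_2}]\cong M'_{P_1}\boxtimes M'_{P_2},\qquad \chi[M_{P_1}\boxtimes M_{P_2}]\cong M'_{\overline{P_2}}\boxtimes M'_{\overline{P_1}}.$$ (b) Let $P$ be a partial order on $[m+n]$.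 As $H_m(0)\otimes H_n(0)$-modules, $$\phi\bigl[M_P\downarrow^{H_{m+n}(0)}_{H_n(0)\otimes H_m(0)}\bigr]\cong M_{\overline P^*}\downarrow^{H_{m+n}(0)}_{H_m(0)\otimes H_n(0)},\qquad \theta\bigl[M_P\downarrow^{H_{m+n}(0)}_{H_m(0)\otimes H_n(0)}\bigr]\cong M'_P\downarrow^{H_{m+n}(0)}_{H_m(0)\otimes H_n(0)},$$ $$\chi\bigl[M_P\downarrow^{H_{m+n}(0)}_{H_m(0)\otimes H_n(0)}\bigr]\cong M'_{\overline P}\downarrow^{H_{m+n}(0)}_{H_m(0)\otimes H_n(0)}.$$ -/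

import Mathlib

open scoped TensorProduct

namespace PosetModules

/-! ### The symmetric group: simple transpositions, length, right descents

The set `[n] = {1, …, n}` is modelled by `Fin n` (so `k ∈ [n]` is the element `k - 1` of `Fin n`), and
`[n - 1]` by `Fin (n - 1)`, which is empty for `n = 0` and `n = 1`. A permutation `γ` is
thought of in one-line notation `γ(1) γ(2) ⋯ γ(n)`. -/

/-- The first of the two positions moved by the `i`-th simple transposition. -/
def pos {n : ℕ} (i : Fin (n - 1)) : Fin n := ⟨i.val, by omega⟩

/-- The second of the two positions moved by the `i`-th simple transposition. -/
def posSucc {n : ℕ} (i : Fin (n - 1)) : Fin n := ⟨i.val + 1, by omega⟩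

/-- The simple transposition `s_i`. -/
def simpleTransp {n : ℕ} (i : Fin (n - 1)) : Equiv.Perm (Fin n) := Equiv.swap (pos i) (posSucc i)

/-- The length of `σ`: the least number of factors in an expression of `σ` as a product of simple
transpositions. -/
noncomputable def length {n : ℕ} (σ : Equiv.Perm (Fin n)) : ℕ :=
  sInf {k | ∃ l : List (Fin (n - 1)), l.length = k ∧ (l.map simpleTransp).prod = σ}

/-- The right descent set `{i | ℓ(σ s_i) < ℓ(σ)}`. -/
def desR {n : ℕ} (σ : Equiv.Perm (Fin n)) : Set (Fin (n - 1)) :=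
  {i | length (σ * simpleTransp i) < length σ}

section Descents

variable {n : ℕ}

lemma pos_lt (i : Fin (n - 1)) : pos i < posSucc i := by
  simp [pos, posSucc, Fin.lt_def]

lemma mul_pos_eq (σ : Equiv.Perm (Fin n)) (i : Fin (n - 1)) :
    (σ * simpleTransp i) (pos i) = σ (posSucc i) := by
  simp [simpleTransp]

lemma mul_posSucc_eq (σ : Equiv.Perm (Fin n)) (i : Fin (n - 1)) :
    (σ * simpleTransp i) (posSucc i) = σ (pos i) := by
  simp [simpleTransp]

lemma simpleTransp_mul_self (i : Fin (n - 1)) : simpleTransp i * simpleTransp i = 1 := by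
  simp [simpleTransp]

/-- The inversions of `σ`, as pairs of positions. -/
def invPairs (σ : Equiv.Perm (Fin n)) : Finset (Fin n × Fin n) :=
  Finset.univ.filter (fun x => x.1 < x.2 ∧ σ x.2 < σ x.1)

lemma mem_invPairs (σ : Equiv.Perm (Fin n)) (a b : Fin n) :
    (a, b) ∈ invPairs σ ↔ a < b ∧ σ b < σ a := by
  simp [invPairs]

lemma card_inv_of_asc (σ : Equiv.Perm (Fin n)) (i : Fin (n - 1))
    (h : σ (pos i) < σ (posSucc i)) :
    (invPairs (σ * simpleTransp i)).card = (invPairs σ).card + 1 := by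
  have key : invPairs (σ * simpleTransp i) = insert (pos i, posSucc i)
      ((invPairs σ).map ((simpleTransp i).prodCongr (simpleTransp i)).toEmbedding) := by
    have hlt : ∀ a b : Fin n, a < b → (a, b) ≠ (pos i, posSucc i) →
        simpleTransp i a < simpleTransp i b := by
      intro a b hab hne
      simp only [simpleTransp, Equiv.swap_apply_def]
      simp only [pos, posSucc, Prod.mk.injEq, Fin.ext_iff, ne_eq, Fin.lt_def] at *
      split_ifs <;> simp_all <;> omega
    have hinv : ∀ a, simpleTransp i (simpleTransp i a) = a := by
      intro a; simp [simpleTransp]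
    ext ⟨a, b⟩
    have hsymm : (simpleTransp i).symm = simpleTransp i := by simp [simpleTransp]
    rw [Finset.mem_insert, Finset.mem_map_equiv, Equiv.prodCongr_symm, Equiv.prodCongr_apply,
      Prod.map_apply, hsymm, mem_invPairs, mem_invPairs, Equiv.Perm.mul_apply,
      Equiv.Perm.mul_apply]
    constructor
    · rintro ⟨h1, h2⟩
      by_cases he : (a, b) = (pos i, posSucc i)
      · exact Or.inl he
      · exact Or.inr ⟨hlt a b h1 he, h2⟩
    · rintro (he | ⟨h1, h2⟩)
      · obtain ⟨rfl, rfl⟩ := Prod.mk.inj he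
        refine ⟨pos_lt i, ?_⟩
        simpa [simpleTransp] using h
      · have hne : (simpleTransp i a, simpleTransp i b) ≠ (pos i, posSucc i) := by
          intro he
          obtain ⟨e1, e2⟩ := Prod.mk.inj he
          rw [e1, e2] at h2
          exact absurd h2 (not_lt.mpr h.le)
        have := hlt _ _ h1 hne
        rw [hinv, hinv] at this
        exact ⟨this, h2⟩
  rw [key, Finset.card_insert_of_notMem, Finset.card_map]
  rw [Finset.mem_map_equiv, Equiv.prodCongr_symm, Equiv.prodCongr_apply, Prod.map_apply,
    mem_invPairs]
  rintro ⟨h1, -⟩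
  have := pos_lt i
  simp [simpleTransp] at h1
  exact absurd h1 (not_lt.mpr this.le)

lemma card_inv_of_desc (σ : Equiv.Perm (Fin n)) (i : Fin (n - 1))
    (h : σ (posSucc i) < σ (pos i)) :
    (invPairs (σ * simpleTransp i)).card + 1 = (invPairs σ).card := by
  have := card_inv_of_asc (σ * simpleTransp i) i (by rw [mul_pos_eq, mul_posSucc_eq]; exact h)
  rw [mul_assoc, simpleTransp_mul_self, mul_one] at this
  exact this.symm

lemma asc_or_desc (σ : Equiv.Perm (Fin n)) (i : Fin (n - 1)) :
    σ (pos i) < σ (posSucc i) ∨ σ (posSucc i) < σ (pos i) :=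
  lt_or_gt_of_ne (fun h => (pos_lt i).ne (σ.injective h))

lemma card_inv_le_word (l : List (Fin (n - 1))) :
    (invPairs (l.map simpleTransp).prod).card ≤ l.length := by
  induction l using List.reverseRecOn with
  | nil =>
    rw [List.map_nil, List.prod_nil, List.length_nil, nonpos_iff_eq_zero,
      Finset.card_eq_zero, Finset.eq_empty_iff_forall_notMem]
    rintro ⟨a, b⟩ hab
    obtain ⟨h1, h2⟩ := (mem_invPairs _ a b).1 hab
    exact absurd h2 (not_lt.mpr h1.le)
  | append_singleton l i ih =>
    simp only [List.map_append, List.map_cons, List.map_nil, List.prod_append, List.prod_cons,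
      List.prod_nil, mul_one, List.length_append, List.length_cons, List.length_nil]
    rcases asc_or_desc (l.map simpleTransp).prod i with h | h
    · rw [card_inv_of_asc _ i h]; omega
    · have := card_inv_of_desc _ i h; omega

lemma eq_one_of_no_desc (σ : Equiv.Perm (Fin n))
    (h : ∀ i : Fin (n - 1), σ (pos i) < σ (posSucc i)) : σ = 1 := by
  have hm : StrictMono σ := by
    rcases n with _ | n
    · intro a; exact a.elim0
    · exact Fin.strictMono_iff_lt_succ.mpr (fun i => h i)
  have : (hm.orderIsoOfSurjective σ σ.surjective) = OrderIso.refl (Fin n) := Subsingleton.elim _ _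
  ext a
  have := congrArg (fun f => f a) this
  simpa using congrArg Fin.val this

lemma exists_word : ∀ (k : ℕ) (σ : Equiv.Perm (Fin n)), (invPairs σ).card = k →
    ∃ l : List (Fin (n - 1)), l.length = k ∧ (l.map simpleTransp).prod = σ := by
  intro k
  induction k with
  | zero =>
    intro σ hσ
    refine ⟨[], rfl, ?_⟩
    rw [eq_one_of_no_desc σ ?_]
    · simp
    · intro i
      rcases asc_or_desc σ i with h | h
      · exact h
      · have := card_inv_of_desc σ i h; omega
  | succ k ih =>
    intro σ hσ
    by_cases hd : ∃ i, σ (posSucc i) < σ (pos i)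
    · obtain ⟨i, hi⟩ := hd
      obtain ⟨l, hl, hp⟩ := ih (σ * simpleTransp i) (by have := card_inv_of_desc σ i hi; omega)
      refine ⟨l ++ [i], by simp [hl], ?_⟩
      simp [hp, mul_assoc, simpleTransp_mul_self]
    · push Not at hd
      have h1 := eq_one_of_no_desc σ
        (fun i => (asc_or_desc σ i).resolve_right (not_lt.mpr (hd i)))
      have h2 := card_inv_le_word (n := n) []
      simp [← h1, hσ] at h2

lemma length_eq_card (σ : Equiv.Perm (Fin n)) : length σ = (invPairs σ).card := by
  apply le_antisymm
  · exact Nat.sInf_le (exists_word _ σ rfl)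
  · refine le_csInf ⟨_, exists_word _ σ rfl⟩ ?_
    rintro k ⟨l, rfl, rfl⟩
    exact card_inv_le_word l

/-- `i` is a right descent of `γ` exactly when `γ(i) > γ(i+1)`. -/
lemma mem_desR_iff (σ : Equiv.Perm (Fin n)) (i : Fin (n - 1)) :
    i ∈ desR σ ↔ σ (posSucc i) < σ (pos i) := by
  simp only [desR, Set.mem_ofPred_eq, length_eq_card]
  rcases asc_or_desc σ i with h | h
  · have := card_inv_of_asc σ i h
    have h' := not_lt.mpr h.le
    simp only [h', iff_false]; omega
  · have := card_inv_of_desc σ i h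
    simp only [h, iff_true]; omega

end Descents

/-! ### Posets on `[n]` and their linear extensions -/

/-- `Poset n` is the set of partial orders on `[n]`. It is a separate type, and not a type class,
so that the order of a poset is never confused with the usual order of `Fin n`. -/
structure Poset (n : ℕ) : Type where
  /-- The partial order. -/
  order : PartialOrder (Fin n)

/-- The order relation `u ⪯_P v`. -/
def Poset.rel {n : ℕ} (P : Poset n) (u v : Fin n) : Prop := P.order.le u v

/-- The poset `P̄`: `u ⪯ v` in `P̄` iff `n + 1 - u ⪯ n + 1 - v` in `P`. -/
def Poset.bar {n : ℕ} (P : Poset n) : Poset n :=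
  ⟨@PartialOrder.lift (Fin n) (Fin n) P.order Fin.rev Fin.rev_injective⟩

/-- The dual poset `P*`: `u ⪯ v` in `P*` iff `v ⪯ u` in `P`. -/
def Poset.star {n : ℕ} (P : Poset n) : Poset n :=
  ⟨{ le := fun u v => P.rel v u
     lt := fun u v => P.rel v u ∧ ¬ P.rel u v
     lt_iff_le_not_ge := fun _ _ => Iff.rfl
     le_refl := fun u => P.order.le_refl u
     le_trans := fun u v w h1 h2 => P.order.le_trans w v u h2 h1
     le_antisymm := fun u v h1 h2 => P.order.le_antisymm u v h2 h1 }⟩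

lemma Poset.bar_rel {n : ℕ} (P : Poset n) (u v : Fin n) :
    P.bar.rel u v ↔ P.rel u.rev v.rev := Iff.rfl

lemma Poset.star_rel {n : ℕ} (P : Poset n) (u v : Fin n) : P.star.rel u v ↔ P.rel v u := Iff.rfl

/-- `E` is a linear extension of `P`: a total order on `[n]` that extends the order of `P`. -/
def IsLinearExtension {n : ℕ} (P E : Poset n) : Prop :=
  (∀ u v, P.rel u v → E.rel u v) ∧ ∀ u v, E.rel u v ∨ E.rel v u

/-- `Σ_R(P) = {E_R | E a linear extension of P}`, where `E_R = i₁ i₂ ⋯ i_n` in one-line notation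
and `i_k` is the `k`-th smallest element of `E`. -/
def SigmaR {n : ℕ} (P : Poset n) : Set (Equiv.Perm (Fin n)) :=
  {γ | ∃ E : Poset n, IsLinearExtension P E ∧ ∀ k l : Fin n, E.rel (γ k) (γ l) ↔ k ≤ l}

lemma mem_SigmaR_iff {n : ℕ} (P : Poset n) (γ : Equiv.Perm (Fin n)) :
    γ ∈ SigmaR P ↔ ∀ k l : Fin n, P.rel (γ k) (γ l) → k ≤ l := by
  constructor
  · rintro ⟨E, ⟨h1, -⟩, h3⟩ k l h
    exact (h3 k l).1 (h1 _ _ h)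
  · intro h
    refine ⟨⟨PartialOrder.lift γ.symm γ.symm.injective⟩, ⟨?_, ?_⟩, ?_⟩
    · intro u v huv
      exact h (γ.symm u) (γ.symm v) (by simpa using huv)
    · intro u v
      exact le_total (γ.symm u) (γ.symm v)
    · intro k l
      change γ.symm (γ k) ≤ γ.symm (γ l) ↔ _
      simp

/-! ### The 0-Hecke algebra -/

/-- The defining relations of `H_n(0)` in the generators `π̄_1, …, π̄_{n-1}`. -/
inductive HeckeRel (n : ℕ) :
    FreeAlgebra ℂ (Fin (n - 1)) → FreeAlgebra ℂ (Fin (n - 1)) → Prop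
  | quad (i : Fin (n - 1)) :
      HeckeRel n (FreeAlgebra.ι ℂ i * FreeAlgebra.ι ℂ i) (-FreeAlgebra.ι ℂ i)
  | braid (i j : Fin (n - 1)) (h : j.val = i.val + 1) :
      HeckeRel n (FreeAlgebra.ι ℂ i * FreeAlgebra.ι ℂ j * FreeAlgebra.ι ℂ i)
        (FreeAlgebra.ι ℂ j * FreeAlgebra.ι ℂ i * FreeAlgebra.ι ℂ j)
  | comm (i j : Fin (n - 1)) (h : i.val + 2 ≤ j.val ∨ j.val + 2 ≤ i.val) :
      HeckeRel n (FreeAlgebra.ι ℂ i * FreeAlgebra.ι ℂ j)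
        (FreeAlgebra.ι ℂ j * FreeAlgebra.ι ℂ i)

/-- The 0-Hecke algebra `H_n(0)` over `ℂ`. -/
def H (n : ℕ) : Type := RingQuot (HeckeRel n)

noncomputable instance (n : ℕ) : Ring (H n) := inferInstanceAs (Ring (RingQuot (HeckeRel n)))

noncomputable instance (n : ℕ) : Algebra ℂ (H n) :=
  inferInstanceAs (Algebra ℂ (RingQuot (HeckeRel n)))

/-- The generator `π̄_i`. -/
noncomputable def opi {n : ℕ} (i : Fin (n - 1)) : H n :=
  RingQuot.mkAlgHom ℂ (HeckeRel n) (FreeAlgebra.ι ℂ i)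

/-- The generator `π_i = π̄_i + 1`. -/
noncomputable def ppi {n : ℕ} (i : Fin (n - 1)) : H n := opi i + 1

section Hecke

variable {n : ℕ}

lemma opi_quad (i : Fin (n - 1)) : (opi i : H n) * opi i = -opi i := by
  have := RingQuot.mkAlgHom_rel ℂ (HeckeRel.quad (n := n) i)
  rw [map_mul, map_neg] at this
  exact this

lemma opi_braid (i j : Fin (n - 1)) (h : j.val = i.val + 1) :
    (opi i : H n) * opi j * opi i = opi j * opi i * opi j := by
  have := RingQuot.mkAlgHom_rel ℂ (HeckeRel.braid (n := n) i j h)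
  simp only [map_mul] at this
  exact this

lemma opi_comm (i j : Fin (n - 1)) (h : i.val + 2 ≤ j.val ∨ j.val + 2 ≤ i.val) :
    (opi i : H n) * opi j = opi j * opi i := by
  have := RingQuot.mkAlgHom_rel ℂ (HeckeRel.comm (n := n) i j h)
  simp only [map_mul] at this
  exact this

/-- The algebra homomorphism from `H_n(0)` with prescribed values on the generators `π̄_i`. -/
noncomputable def liftH {B : Type*} [Ring B] [Algebra ℂ B] (f : Fin (n - 1) → B)
    (hq : ∀ i, f i * f i = -f i)
    (hb : ∀ i j : Fin (n - 1), j.val = i.val + 1 → f i * f j * f i = f j * f i * f j)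
    (hc : ∀ i j : Fin (n - 1), i.val + 2 ≤ j.val ∨ j.val + 2 ≤ i.val → f i * f j = f j * f i) :
    H n →ₐ[ℂ] B :=
  RingQuot.liftAlgHom ℂ ⟨FreeAlgebra.lift ℂ f, by
    intro x y hxy
    cases hxy with
    | quad i => simpa using hq i
    | braid i j h => simpa using hb i j h
    | comm i j h => simpa using hc i j h⟩

lemma liftH_opi {B : Type*} [Ring B] [Algebra ℂ B] (f : Fin (n - 1) → B) (hq hb hc)
    (i : Fin (n - 1)) : liftH (n := n) f hq hb hc (opi i) = f i := by
  unfold liftH opi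
  refine (RingQuot.liftAlgHom_mkAlgHom_apply ℂ _ _ _).trans ?_
  simp

lemma algHom_ext {B : Type*} [Ring B] [Algebra ℂ B] {f g : H n →ₐ[ℂ] B}
    (h : ∀ i : Fin (n - 1), f (opi i) = g (opi i)) : f = g := by
  apply RingQuot.ringQuot_ext'
  apply FreeAlgebra.hom_ext
  funext i
  exact h i

/-- `φ : H_n(0) → H_n(0)`, `φ(π̄_i) = π̄_{n-i}`, as a homomorphism. -/
noncomputable def phiHom (n : ℕ) : H n →ₐ[ℂ] H n :=
  liftH (fun i => opi i.rev) (fun i => opi_quad _)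
    (fun i j h => by
      have hi : i.rev.val = j.rev.val + 1 := by simp only [Fin.val_rev]; omega
      exact (opi_braid j.rev i.rev hi).symm)
    (fun i j h => by
      refine opi_comm _ _ ?_
      simp only [Fin.val_rev]; omega)

/-- The involution `φ` of `H_n(0)`: `φ(π̄_i) = π̄_{n-i}`. -/
noncomputable def phi (n : ℕ) : H n ≃ₐ[ℂ] H n :=
  have h : (phiHom n).comp (phiHom n) = AlgHom.id ℂ (H n) :=
    algHom_ext fun i => by simp [phiHom, liftH_opi]
  AlgEquiv.ofAlgHom (phiHom n) (phiHom n) h h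

lemma phi_opi (i : Fin (n - 1)) : phi n (opi i) = opi i.rev := liftH_opi _ _ _ _ _

/-- `θ : H_n(0) → H_n(0)`, `θ(π̄_i) = -π_i`, as a homomorphism. -/
noncomputable def thetaHom (n : ℕ) : H n →ₐ[ℂ] H n :=
  liftH (fun i => -ppi i)
    (fun i => by
      have := opi_quad i
      simp only [ppi, neg_mul_neg, mul_add, add_mul, this, mul_one, one_mul]
      abel)
    (fun i j h => by
      have h1 := opi_quad i
      have h2 := opi_quad j
      have h3 := opi_braid i j h
      simp only [ppi]
      have e1 : -(opi i + 1) * -(opi j + 1) * -(opi i + 1)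
        = -(opi i * opi j * opi i + opi i * opi j + opi j * opi i + (opi i * opi i + opi i)
          + opi i + opi j + 1) := by noncomm_ring
      have e2 : -(opi j + 1) * -(opi i + 1) * -(opi j + 1)
        = -(opi j * opi i * opi j + opi i * opi j + opi j * opi i + (opi j * opi j + opi j)
          + opi i + opi j + 1) := by noncomm_ring
      rw [e1, e2, h1, h2, h3]; noncomm_ring)
    (fun i j h => by
      have h3 := opi_comm i j h
      simp only [ppi, neg_mul_neg, mul_add, add_mul, h3, mul_one, one_mul]
      abel)

/-- The involution `θ` of `H_n(0)`: `θ(π̄_i) = -π_i`. -/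
noncomputable def theta (n : ℕ) : H n ≃ₐ[ℂ] H n :=
  have h : (thetaHom n).comp (thetaHom n) = AlgHom.id ℂ (H n) :=
    algHom_ext fun i => by simp [thetaHom, liftH_opi, ppi]
  AlgEquiv.ofAlgHom (thetaHom n) (thetaHom n) h h

lemma theta_opi (i : Fin (n - 1)) : theta n (opi i) = -ppi i := liftH_opi _ _ _ _ _

/-- `χ`, as a homomorphism to the opposite algebra. -/
noncomputable def chiHom (n : ℕ) : H n →ₐ[ℂ] (H n)ᵐᵒᵖ :=
  liftH (fun i => MulOpposite.op (opi i))
    (fun i => by rw [← MulOpposite.op_mul, opi_quad, MulOpposite.op_neg])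
    (fun i j h => by
      simp only [← MulOpposite.op_mul, ← mul_assoc]
      rw [opi_braid i j h])
    (fun i j h => by simp only [← MulOpposite.op_mul]; rw [opi_comm i j h])

/-- The anti-involution `χ` of `H_n(0)`, `χ(π̄_i) = π̄_i`, an anti-automorphism of an algebra `A`
being written as an isomorphism from `A` to its opposite algebra. -/
noncomputable def chi (n : ℕ) : H n ≃ₐ[ℂ] (H n)ᵐᵒᵖ :=
  AlgEquiv.ofAlgHom (chiHom n) (AlgHom.opComm (chiHom n))
    (by
      apply AlgHom.opComm.symm.injective
      refine algHom_ext fun i => ?_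
      simp [AlgHom.opComm, chiHom, liftH_opi])
    (algHom_ext fun i => by simp [AlgHom.opComm, chiHom, liftH_opi])

lemma chi_opi (i : Fin (n - 1)) : chi n (opi i) = MulOpposite.op (opi i) := liftH_opi _ _ _ _ _

end Hecke

/-! ### The algebra `H_m(0) ⊗ H_n(0)` inside `H_{m+n}(0)` -/

section Parabolic

variable {a b N : ℕ}

/-- `H_a(0) → H_{a+b}(0)`, `π̄_i ↦ π̄_i`. -/
noncomputable def embLeft (h : a + b = N) : H a →ₐ[ℂ] H N :=
  liftH (fun i => opi (⟨i.val, by omega⟩ : Fin (N - 1))) (fun i => opi_quad _)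
    (fun i j hij => opi_braid _ _ hij) (fun i j hij => opi_comm _ _ hij)

/-- `H_b(0) → H_{a+b}(0)`, `π̄_j ↦ π̄_{a+j}`. -/
noncomputable def embRight (h : a + b = N) : H b →ₐ[ℂ] H N :=
  liftH (fun j => opi (⟨a + j.val, by omega⟩ : Fin (N - 1))) (fun i => opi_quad _)
    (fun i j hij => opi_braid _ _ (by simp only; omega))
    (fun i j hij => opi_comm _ _ (by simp only; omega))

lemma closure_opi {n : ℕ} : Algebra.adjoin ℂ (Set.range (opi (n := n))) = ⊤ := by
  have h := congrArg (Subalgebra.map (RingQuot.mkAlgHom ℂ (HeckeRel n)))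
    (FreeAlgebra.adjoin_range_ι (R := ℂ) (X := Fin (n - 1)))
  rw [AlgHom.map_adjoin, Algebra.map_top, ← Set.range_comp,
    (AlgHom.range_eq_top _).mpr (RingQuot.mkAlgHom_surjective ℂ (HeckeRel n))] at h
  exact h

lemma embLeft_commute_embRight (h : a + b = N) (x : H a) (y : H b) :
    Commute (embLeft h x) (embRight h y) := by
  have gen : ∀ i j, Commute (embLeft h (opi i)) (embRight h (opi j)) := by
    intro i j
    simp only [embLeft, embRight, liftH_opi]
    exact opi_comm _ _ (Or.inl (by simp only; omega))
  have hx : x ∈ Algebra.adjoin ℂ (Set.range (opi (n := a))) := by rw [closure_opi]; trivial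
  have hy : y ∈ Algebra.adjoin ℂ (Set.range (opi (n := b))) := by rw [closure_opi]; trivial
  have step : ∀ i, Commute (embLeft h (opi i)) (embRight h y) := by
    intro i
    induction hy using Algebra.adjoin_induction with
    | mem z hz => obtain ⟨j, rfl⟩ := hz; exact gen i j
    | algebraMap r => rw [AlgHom.commutes]; exact (Algebra.commutes r _).symm
    | add u v _ _ hu hv => rw [map_add]; exact hu.add_right hv
    | mul u v _ _ hu hv => rw [map_mul]; exact hu.mul_right hv
  induction hx using Algebra.adjoin_induction with
  | mem z hz => obtain ⟨i, rfl⟩ := hz; exact step i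
  | algebraMap r => rw [AlgHom.commutes]; exact Algebra.commutes r _
  | add u v _ _ hu hv => rw [map_add]; exact hu.add_left hv
  | mul u v _ _ hu hv => rw [map_mul]; exact hu.mul_left hv

/-- The homomorphism `H_a(0) ⊗ H_b(0) → H_{a+b}(0)`, `π̄_i ⊗ 1 ↦ π̄_i`, `1 ⊗ π̄_j ↦ π̄_{a+j}`,
through which `H_a(0) ⊗ H_b(0)` is viewed as the subalgebra of `H_{a+b}(0)` generated by the
generators other than the `a`-th one. -/
noncomputable def emb (h : a + b = N) : H a ⊗[ℂ] H b →ₐ[ℂ] H N :=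
  Algebra.TensorProduct.lift (embLeft h) (embRight h) (embLeft_commute_embRight h)

lemma emb_tmul (h : a + b = N) (x : H a) (y : H b) :
    emb h (x ⊗ₜ y) = embLeft h x * embRight h y :=
  Algebra.TensorProduct.lift_tmul _ _ _ _ _

/-- The restriction of `φ` to `H_a(0) ⊗ H_b(0)`, which is an isomorphism onto `H_b(0) ⊗ H_a(0)`:
`x ⊗ y ↦ φ(y) ⊗ φ(x)`. -/
noncomputable def phiRes (a b : ℕ) : H a ⊗[ℂ] H b ≃ₐ[ℂ] H b ⊗[ℂ] H a :=
  (Algebra.TensorProduct.comm ℂ (H a) (H b)).trans (Algebra.TensorProduct.congr (phi b) (phi a))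

/-- The restriction of `θ` to `H_a(0) ⊗ H_b(0)`: `x ⊗ y ↦ θ(x) ⊗ θ(y)`. -/
noncomputable def thetaRes (a b : ℕ) : H a ⊗[ℂ] H b ≃ₐ[ℂ] H a ⊗[ℂ] H b :=
  Algebra.TensorProduct.congr (theta a) (theta b)

/-- The restriction of `χ` to `H_a(0) ⊗ H_b(0)`: `x ⊗ y ↦ χ(x) ⊗ χ(y)`. -/
noncomputable def chiRes (a b : ℕ) : H a ⊗[ℂ] H b ≃ₐ[ℂ] (H a ⊗[ℂ] H b)ᵐᵒᵖ :=
  (Algebra.TensorProduct.congr (chi a) (chi b)).trans (Algebra.TensorProduct.opAlgEquiv ℂ ℂ _ _)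

lemma algHom_tensor_ext {B : Type*} [Ring B] [Algebra ℂ B] {f g : H a ⊗[ℂ] H b →ₐ[ℂ] B}
    (h1 : ∀ i : Fin (a - 1), f (opi i ⊗ₜ 1) = g (opi i ⊗ₜ 1))
    (h2 : ∀ i : Fin (b - 1), f (1 ⊗ₜ opi i) = g (1 ⊗ₜ opi i)) : f = g := by
  apply Algebra.TensorProduct.ext
  · exact algHom_ext h1
  · exact algHom_ext h2

/-- `phiRes` is the restriction of `φ`. -/
lemma emb_phiRes (h : a + b = N) (h' : b + a = N) (x : H a ⊗[ℂ] H b) :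
    emb h' (phiRes a b x) = phi N (emb h x) := by
  suffices (emb h').comp (phiRes a b).toAlgHom = (phi N).toAlgHom.comp (emb h) from
    DFunLike.congr_fun this x
  apply algHom_tensor_ext
  · intro i
    simp [phiRes, emb_tmul, phi_opi, embLeft, embRight, liftH_opi]
    congr 1; ext; simp [Fin.val_rev]; omega
  · intro i
    simp [phiRes, emb_tmul, phi_opi, embLeft, embRight, liftH_opi]
    congr 1; ext; simp [Fin.val_rev]; omega

/-- `thetaRes` is the restriction of `θ`. -/
lemma emb_thetaRes (h : a + b = N) (x : H a ⊗[ℂ] H b) :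
    emb h (thetaRes a b x) = theta N (emb h x) := by
  suffices (emb h).comp (thetaRes a b).toAlgHom = (theta N).toAlgHom.comp (emb h) from
    DFunLike.congr_fun this x
  apply algHom_tensor_ext <;> intro i <;>
    simp [thetaRes, emb_tmul, theta_opi, embLeft, embRight, liftH_opi, ppi]

/-- `chiRes` is the restriction of `χ`. -/
lemma emb_chiRes (h : a + b = N) (x : H a ⊗[ℂ] H b) :
    emb h (chiRes a b x).unop = (chi N (emb h x)).unop := by
  suffices (AlgHom.op (emb h)).comp (chiRes a b).toAlgHom = (chi N).toAlgHom.comp (emb h) from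
    congrArg MulOpposite.unop (DFunLike.congr_fun this x)
  apply algHom_tensor_ext <;> intro i <;>
    simp [chiRes, emb_tmul, chi_opi, embLeft, embRight, liftH_opi,
      Algebra.TensorProduct.opAlgEquiv_apply]

end Parabolic

/-! ### Operations on right modules

A right module over a `ℂ`-algebra `A` is a module over `Aᵐᵒᵖ`, so that `v · h` is
`MulOpposite.op h • v`; its `ℂ`-vector space structure is part of the data. -/

section Operations

variable {A B : Type*} [Ring A] [Algebra ℂ A] [Ring B] [Algebra ℂ B]

/-- Pullback of a right `B`-module along a homomorphism `f : A → B`: the same vector space, with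
`v · h = v · f(h)`. For an inclusion `f` this is the restriction `V↓`. -/
@[nolint unusedArguments]
def Res (_f : A →ₐ[ℂ] B) (V : Type*) : Type _ := V

instance (f : A →ₐ[ℂ] B) (V : Type*) [AddCommGroup V] : AddCommGroup (Res f V) :=
  inferInstanceAs (AddCommGroup V)

instance (f : A →ₐ[ℂ] B) (V : Type*) [AddCommGroup V] [Module ℂ V] : Module ℂ (Res f V) :=
  inferInstanceAs (Module ℂ V)

instance (f : A →ₐ[ℂ] B) (V : Type*) [AddCommGroup V] [Module Bᵐᵒᵖ V] : Module Aᵐᵒᵖ (Res f V) :=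
  Module.compHom V (AlgHom.op f).toRingHom

/-- The identity of the underlying vector spaces. -/
def Res.equiv (f : A →ₐ[ℂ] B) (V : Type*) [AddCommGroup V] [Module ℂ V] : Res f V ≃ₗ[ℂ] V :=
  LinearEquiv.refl ℂ V

lemma Res.equiv_smul (f : A →ₐ[ℂ] B) (V : Type*) [AddCommGroup V] [Module ℂ V] [Module Bᵐᵒᵖ V]
    (h : A) (v : Res f V) :
    Res.equiv f V (MulOpposite.op h • v) = MulOpposite.op (f h) • Res.equiv f V v := rfl

instance (f : A →ₐ[ℂ] B) (V : Type*) [AddCommGroup V] [Module ℂ V] [Module Bᵐᵒᵖ V]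
    [IsScalarTower ℂ Bᵐᵒᵖ V] : IsScalarTower ℂ Aᵐᵒᵖ (Res f V) where
  smul_assoc c x v := by
    change AlgHom.op f (c • x) • Res.equiv f V v = c • (AlgHom.op f x • Res.equiv f V v)
    rw [map_smul, smul_assoc]

/-- The twist `μ[V]` of a right `B`-module along an isomorphism `μ : A → B` (an automorphism if
`A = B`): the same vector space, with `v ·_μ h = v · μ(h)`. -/
abbrev Twist (μ : A ≃ₐ[ℂ] B) (V : Type*) : Type _ := Res (μ : A →ₐ[ℂ] B) V

/-- The twist `ν[V]` of a right `A`-module by an anti-automorphism `ν` of `A`: the dual space `V*`,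
with `(δ ·^ν h)(v) = δ(v · ν(h))`. -/
@[nolint unusedArguments]
def DualTwist (_ν : A ≃ₐ[ℂ] Aᵐᵒᵖ) (V : Type*) [AddCommGroup V] [Module ℂ V] : Type _ :=
  Module.Dual ℂ V

section

variable (ν : A ≃ₐ[ℂ] Aᵐᵒᵖ) (V : Type*) [AddCommGroup V] [Module ℂ V]

instance : AddCommGroup (DualTwist ν V) := inferInstanceAs (AddCommGroup (Module.Dual ℂ V))
instance : Module ℂ (DualTwist ν V) := inferInstanceAs (Module ℂ (Module.Dual ℂ V))

/-- The identity of the underlying vector spaces. -/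
def DualTwist.equiv : DualTwist ν V ≃ₗ[ℂ] Module.Dual ℂ V := LinearEquiv.refl ℂ _

lemma DualTwist.ext {δ ε : DualTwist ν V}
    (h : ∀ v, DualTwist.equiv ν V δ v = DualTwist.equiv ν V ε v) : δ = ε :=
  (DualTwist.equiv ν V).injective (LinearMap.ext h)

variable [Module Aᵐᵒᵖ V] [IsScalarTower ℂ Aᵐᵒᵖ V]

instance : SMul Aᵐᵒᵖ (DualTwist ν V) where
  smul h δ := (DualTwist.equiv ν V).symm
    (DualTwist.equiv ν V δ ∘ₗ Algebra.lsmul ℂ ℂ V (ν h.unop))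

lemma DualTwist.smul_apply (h : A) (δ : DualTwist ν V) (v : V) :
    DualTwist.equiv ν V (MulOpposite.op h • δ) v = DualTwist.equiv ν V δ (ν h • v) := rfl

instance : Module Aᵐᵒᵖ (DualTwist ν V) where
  one_smul δ := by
    refine DualTwist.ext ν V fun v => ?_
    rw [← MulOpposite.op_one, DualTwist.smul_apply, map_one, one_smul]
  mul_smul x y δ := by
    refine DualTwist.ext ν V fun v => ?_
    induction x using MulOpposite.rec' with | _ x
    induction y using MulOpposite.rec' with | _ y
    rw [← MulOpposite.op_mul]
    simp only [DualTwist.smul_apply, map_mul, mul_smul]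
  smul_zero x := by
    refine DualTwist.ext ν V fun v => ?_
    induction x using MulOpposite.rec' with | _ x
    simp [DualTwist.smul_apply]
  smul_add x δ ε := by
    refine DualTwist.ext ν V fun v => ?_
    induction x using MulOpposite.rec' with | _ x
    simp [DualTwist.smul_apply]
  add_smul x y δ := by
    refine DualTwist.ext ν V fun v => ?_
    induction x using MulOpposite.rec' with | _ x
    induction y using MulOpposite.rec' with | _ y
    rw [← MulOpposite.op_add, map_add, LinearMap.add_apply]
    simp only [DualTwist.smul_apply, map_add, add_smul]
  zero_smul δ := by
    refine DualTwist.ext ν V fun v => ?_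
    rw [← MulOpposite.op_zero, DualTwist.smul_apply]
    simp

instance : IsScalarTower ℂ Aᵐᵒᵖ (DualTwist ν V) where
  smul_assoc c x δ := by
    refine DualTwist.ext ν V fun v => ?_
    induction x using MulOpposite.rec' with | _ x
    have h2 : DualTwist.equiv ν V (c • MulOpposite.op x • δ) v
      = c • DualTwist.equiv ν V (MulOpposite.op x • δ) v := rfl
    rw [← MulOpposite.op_smul, h2, DualTwist.smul_apply, DualTwist.smul_apply, map_smul ν,
      smul_assoc, (DualTwist.equiv ν V δ).map_smul]

end

/-- The right `A ⊗ B`-module `V ⊗ W`, for a right `A`-module `V` and a right `B`-module `W`: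
`(v ⊗ w) · (x ⊗ y) = (v · x) ⊗ (w · y)`. -/
@[nolint unusedArguments]
def OuterTensor (A B : Type*) [Ring A] [Algebra ℂ A] [Ring B] [Algebra ℂ B] (V W : Type*)
    [AddCommGroup V] [Module ℂ V] [AddCommGroup W] [Module ℂ W] : Type _ := V ⊗[ℂ] W

section

variable (A B) (V W : Type*) [AddCommGroup V] [Module ℂ V] [Module Aᵐᵒᵖ V]
  [IsScalarTower ℂ Aᵐᵒᵖ V] [AddCommGroup W] [Module ℂ W] [Module Bᵐᵒᵖ W]
  [IsScalarTower ℂ Bᵐᵒᵖ W]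

/-- The action of `(A ⊗ B)ᵐᵒᵖ` on `V ⊗ W`. -/
noncomputable def outerAction : (A ⊗[ℂ] B)ᵐᵒᵖ →ₐ[ℂ] Module.End ℂ (V ⊗[ℂ] W) :=
  ((Module.endTensorEndAlgHom (R := ℂ) (S := ℂ) (A := ℂ) (M := V) (N := W)).comp
    (Algebra.TensorProduct.map (Algebra.lsmul ℂ ℂ V : Aᵐᵒᵖ →ₐ[ℂ] Module.End ℂ V)
      (Algebra.lsmul ℂ ℂ W : Bᵐᵒᵖ →ₐ[ℂ] Module.End ℂ W))).comp
    (Algebra.TensorProduct.opAlgEquiv ℂ ℂ A B).symm.toAlgHom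

noncomputable instance : AddCommGroup (OuterTensor A B V W) :=
  inferInstanceAs (AddCommGroup (V ⊗[ℂ] W))
noncomputable instance : Module ℂ (OuterTensor A B V W) := inferInstanceAs (Module ℂ (V ⊗[ℂ] W))
noncomputable instance : Module (A ⊗[ℂ] B)ᵐᵒᵖ (OuterTensor A B V W) :=
  Module.compHom (V ⊗[ℂ] W) (outerAction A B V W).toRingHom
instance : IsScalarTower ℂ (A ⊗[ℂ] B)ᵐᵒᵖ (OuterTensor A B V W) where
  smul_assoc c x v := by
    change outerAction A B V W (c • x) (v : V ⊗[ℂ] W)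
      = c • outerAction A B V W x (v : V ⊗[ℂ] W)
    rw [map_smul]; rfl

lemma OuterTensor.smul_tmul (x : A) (y : B) (v : V) (w : W) :
    MulOpposite.op (x ⊗ₜ[ℂ] y) • (show OuterTensor A B V W from v ⊗ₜ[ℂ] w)
      = (show OuterTensor A B V W from (MulOpposite.op x • v) ⊗ₜ[ℂ] (MulOpposite.op y • w)) := by
  change outerAction A B V W (MulOpposite.op (x ⊗ₜ[ℂ] y)) (v ⊗ₜ[ℂ] w) = _
  simp [outerAction, Module.endTensorEndAlgHom_apply]

end

section

variable (f : A →ₐ[ℂ] B) (V : Type*) [AddCommGroup V] [Module ℂ V] [Module Aᵐᵒᵖ V]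

/-- The relations `(v · a) ⊗ h = v ⊗ f(a) h` of the tensor product `V ⊗_A B`. -/
def indRelations : Submodule ℂ (V ⊗[ℂ] B) :=
  Submodule.span ℂ {z | ∃ (v : V) (a : A) (h : B),
    z = (MulOpposite.op a • v) ⊗ₜ[ℂ] h - v ⊗ₜ[ℂ] (f a * h)}

/-- The induced right `B`-module `V↑ = V ⊗_A B` of a right `A`-module `V` along `f : A → B`:
the quotient of `V ⊗_ℂ B` by the relations `(v · a) ⊗ h = v ⊗ f(a) h`, with
`(v ⊗ h) · h' = v ⊗ h h'`. -/
def Ind : Type _ := (V ⊗[ℂ] B) ⧸ indRelations f V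

/-- Right multiplication by `h' : B` on `V ⊗_ℂ B`. -/
noncomputable def rightMul : Bᵐᵒᵖ →ₐ[ℂ] Module.End ℂ (V ⊗[ℂ] B) :=
  (Module.endTensorEndAlgHom (R := ℂ) (S := ℂ) (A := ℂ) (M := V) (N := B)).comp
    (Algebra.TensorProduct.includeRight.comp (Algebra.lsmul ℂ ℂ B))

lemma rightMul_tmul (h' : Bᵐᵒᵖ) (v : V) (h : B) :
    rightMul (B := B) V h' (v ⊗ₜ h) = v ⊗ₜ (h * h'.unop) := by
  simp [rightMul, Module.endTensorEndAlgHom_apply]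

lemma rightMul_mem (h' : Bᵐᵒᵖ) :
    indRelations f V ≤ (indRelations f V).comap (rightMul V h') := by
  refine Submodule.span_le.mpr ?_
  rintro _ ⟨v, a, h, rfl⟩
  refine Submodule.subset_span ⟨v, a, h * h'.unop, ?_⟩
  rw [map_sub, rightMul_tmul, rightMul_tmul, mul_assoc]

noncomputable instance : AddCommGroup (Ind f V) :=
  inferInstanceAs (AddCommGroup ((V ⊗[ℂ] B) ⧸ indRelations f V))
noncomputable instance : Module ℂ (Ind f V) :=
  inferInstanceAs (Module ℂ ((V ⊗[ℂ] B) ⧸ indRelations f V))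

/-- The class of `v ⊗ h` in `V ⊗_A B`. -/
noncomputable def Ind.mk (z : V ⊗[ℂ] B) : Ind f V := Submodule.Quotient.mk z

lemma Ind.mk_surjective : Function.Surjective (Ind.mk f V) :=
  Submodule.Quotient.mk_surjective _

noncomputable instance : Module Bᵐᵒᵖ (Ind f V) where
  smul h' z := (indRelations f V).mapQ (indRelations f V) (rightMul V h') (rightMul_mem f V h') z
  one_smul z := by
    obtain ⟨z, rfl⟩ := Ind.mk_surjective f V z
    change Ind.mk f V (rightMul V 1 z) = Ind.mk f V z
    rw [map_one]; rfl
  mul_smul x y z := by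
    obtain ⟨z, rfl⟩ := Ind.mk_surjective f V z
    change Ind.mk f V (rightMul V (x * y) z) = Ind.mk f V (rightMul V x (rightMul V y z))
    rw [map_mul]; rfl
  smul_zero x := map_zero _
  smul_add x z w := map_add _ _ _
  add_smul x y z := by
    obtain ⟨z, rfl⟩ := Ind.mk_surjective f V z
    change Ind.mk f V (rightMul V (x + y) z) = Ind.mk f V (rightMul V x z + rightMul V y z)
    rw [map_add]; rfl
  zero_smul z := by
    obtain ⟨z, rfl⟩ := Ind.mk_surjective f V z
    change Ind.mk f V (rightMul V 0 z) = Ind.mk f V 0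
    rw [map_zero]; rfl

lemma Ind.smul_mk (h' h : B) (v : V) :
    MulOpposite.op h' • Ind.mk f V (v ⊗ₜ h) = Ind.mk f V (v ⊗ₜ (h * h')) :=
  congrArg (Ind.mk f V) (rightMul_tmul V (MulOpposite.op h') v h)

instance : IsScalarTower ℂ Bᵐᵒᵖ (Ind f V) where
  smul_assoc c x z := by
    obtain ⟨z, rfl⟩ := Ind.mk_surjective f V z
    change Ind.mk f V (rightMul V (c • x) z) = Ind.mk f V (c • rightMul V x z)
    rw [map_smul]; rfl

end

end Operations

/-- The induction product `V ⊠ W = (V ⊗ W)↑` from `H_a(0) ⊗ H_b(0)` to `H_{a+b}(0)`. -/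
abbrev IndProd {a b N : ℕ} (h : a + b = N) (V W : Type*)
    [AddCommGroup V] [Module ℂ V] [Module (H a)ᵐᵒᵖ V] [IsScalarTower ℂ (H a)ᵐᵒᵖ V]
    [AddCommGroup W] [Module ℂ W] [Module (H b)ᵐᵒᵖ W] [IsScalarTower ℂ (H b)ᵐᵒᵖ W] : Type _ :=
  Ind (emb h) (OuterTensor (H a) (H b) V W)

/-! ### The poset modules -/

section PosetModule

variable {n : ℕ}

open Classical in
/-- The operator on `ℂ Σ_R(P)` sending a basis element `γ` to `c γ` if `i` is a right descent of
`γ`, to `0` if it is not and `γ s_i ∉ Σ_R(P)`, and to `γ s_i` if it is not and `γ s_i ∈ Σ_R(P)`. -/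
noncomputable def posetOp (c : ℂ) (P : Poset n) (i : Fin (n - 1)) :
    Module.End ℂ (SigmaR P →₀ ℂ) :=
  Finsupp.lift (SigmaR P →₀ ℂ) ℂ (SigmaR P) fun γ =>
    if i ∈ desR γ.val then Finsupp.single γ c
    else if h : γ.val * simpleTransp i ∈ SigmaR P then Finsupp.single ⟨γ.val * simpleTransp i, h⟩ 1
    else 0

open Classical in
/-- The same rule on all permutations, with membership in `Σ_R(P)` read off locally. -/
noncomputable def fullOp (c : ℂ) (P : Poset n) (i : Fin (n - 1)) :
    Module.End ℂ (Equiv.Perm (Fin n) →₀ ℂ) :=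
  Finsupp.lift (Equiv.Perm (Fin n) →₀ ℂ) ℂ (Equiv.Perm (Fin n)) fun γ =>
    if γ (posSucc i) < γ (pos i) then Finsupp.single γ c
    else if P.rel (γ (pos i)) (γ (posSucc i)) then 0
    else Finsupp.single (γ * simpleTransp i) 1

lemma fullOp_desc (c : ℂ) (P : Poset n) (i : Fin (n - 1)) (γ : Equiv.Perm (Fin n)) (r : ℂ)
    (h : γ (posSucc i) < γ (pos i)) :
    fullOp c P i (Finsupp.single γ r) = Finsupp.single γ (r * c) := by
  simp [fullOp, h]

lemma fullOp_zero (c : ℂ) (P : Poset n) (i : Fin (n - 1)) (γ : Equiv.Perm (Fin n)) (r : ℂ)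
    (h : γ (pos i) < γ (posSucc i)) (h' : P.rel (γ (pos i)) (γ (posSucc i))) :
    fullOp c P i (Finsupp.single γ r) = 0 := by
  simp [fullOp, not_lt.mpr h.le, h']

lemma fullOp_asc (c : ℂ) (P : Poset n) (i : Fin (n - 1)) (γ : Equiv.Perm (Fin n)) (r : ℂ)
    (h : γ (pos i) < γ (posSucc i)) (h' : ¬ P.rel (γ (pos i)) (γ (posSucc i))) :
    fullOp c P i (Finsupp.single γ r) = Finsupp.single (γ * simpleTransp i) r := by
  simp [fullOp, not_lt.mpr h.le, h']

lemma fullOp_quad (c : ℂ) (P : Poset n) (i : Fin (n - 1)) :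
    fullOp c P i * fullOp c P i = c • fullOp c P i := by
  refine Finsupp.lhom_ext fun γ r => ?_
  rw [Module.End.mul_apply, LinearMap.smul_apply]
  rcases asc_or_desc γ i with h | h
  · by_cases h' : P.rel (γ (pos i)) (γ (posSucc i))
    · rw [fullOp_zero c P i γ r h h', map_zero, smul_zero]
    · rw [fullOp_asc c P i γ r h h', fullOp_desc c P i _ _
        (by rw [mul_pos_eq, mul_posSucc_eq]; exact h)]
      simp [mul_comm]
  · rw [fullOp_desc c P i γ r h, fullOp_desc c P i γ _ h]
    rw [Finsupp.smul_single', mul_comm c]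

lemma fullOp_comm (c : ℂ) (P : Poset n) (i j : Fin (n - 1)) (hij : i.val + 2 ≤ j.val) :
    fullOp c P i * fullOp c P j = fullOp c P j * fullOp c P i := by
  have d1 : pos j ≠ pos i := by simp only [pos, ne_eq, Fin.ext_iff]; omega
  have d2 : pos j ≠ posSucc i := by simp only [pos, posSucc, ne_eq, Fin.ext_iff]; omega
  have d3 : posSucc j ≠ pos i := by simp only [pos, posSucc, ne_eq, Fin.ext_iff]; omega
  have d4 : posSucc j ≠ posSucc i := by simp only [posSucc, ne_eq, Fin.ext_iff]; omega
  have e1 : ∀ γ : Equiv.Perm (Fin n), (γ * simpleTransp i) (pos j) = γ (pos j) := fun γ => by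
    simp [simpleTransp, Equiv.swap_apply_of_ne_of_ne d1 d2]
  have e2 : ∀ γ : Equiv.Perm (Fin n), (γ * simpleTransp i) (posSucc j) = γ (posSucc j) :=
    fun γ => by simp [simpleTransp, Equiv.swap_apply_of_ne_of_ne d3 d4]
  have e3 : ∀ γ : Equiv.Perm (Fin n), (γ * simpleTransp j) (pos i) = γ (pos i) := fun γ => by
    simp [simpleTransp, Equiv.swap_apply_of_ne_of_ne d1.symm d3.symm]
  have e4 : ∀ γ : Equiv.Perm (Fin n), (γ * simpleTransp j) (posSucc i) = γ (posSucc i) :=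
    fun γ => by simp [simpleTransp, Equiv.swap_apply_of_ne_of_ne d2.symm d4.symm]
  have e5 : simpleTransp j * simpleTransp i = simpleTransp i * simpleTransp j := by
    refine Equiv.ext fun x => ?_
    simp only [Equiv.Perm.mul_apply, simpleTransp, Equiv.swap_apply_def]
    grind
  refine Finsupp.lhom_ext fun γ r => ?_
  rw [Module.End.mul_apply, Module.End.mul_apply]
  rcases asc_or_desc γ i with hi | hi <;> rcases asc_or_desc γ j with hj | hj <;>
    by_cases hi' : P.rel (γ (pos i)) (γ (posSucc i)) <;>
    by_cases hj' : P.rel (γ (pos j)) (γ (posSucc j)) <;>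
    simp [fullOp_desc, fullOp_zero, fullOp_asc, hi, hj, hi', hj', e1, e2, e3, e4, mul_assoc, e5,
      -Equiv.Perm.coe_mul, -Finsupp.single_mul]

lemma fullOp_braid (c : ℂ) (P : Poset n) (i j : Fin (n - 1)) (hij : j.val = i.val + 1) :
    fullOp c P i * fullOp c P j * fullOp c P i = fullOp c P j * fullOp c P i * fullOp c P j := by
  have hq : pos j = posSucc i := by simp only [pos, posSucc, Fin.ext_iff]; omega
  have d1 : pos i ≠ posSucc i := (pos_lt i).ne
  have d2 : posSucc j ≠ pos i := by simp only [pos, posSucc, ne_eq, Fin.ext_iff]; omega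
  have d3 : posSucc j ≠ posSucc i := by simp only [posSucc, ne_eq, Fin.ext_iff]; omega
  have e1 := fun γ : Equiv.Perm (Fin n) => mul_pos_eq γ i
  have e2 := fun γ : Equiv.Perm (Fin n) => mul_posSucc_eq γ i
  have e3 : ∀ γ : Equiv.Perm (Fin n), (γ * simpleTransp i) (posSucc j) = γ (posSucc j) :=
    fun γ => by simp [simpleTransp, Equiv.swap_apply_of_ne_of_ne d2 d3]
  have e4 : ∀ γ : Equiv.Perm (Fin n), (γ * simpleTransp j) (posSucc i) = γ (posSucc j) :=
    fun γ => by rw [← hq]; exact mul_pos_eq γ j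
  have e5 : ∀ γ : Equiv.Perm (Fin n), (γ * simpleTransp j) (posSucc j) = γ (posSucc i) :=
    fun γ => by rw [← hq]; exact mul_posSucc_eq γ j
  have e6 : ∀ γ : Equiv.Perm (Fin n), (γ * simpleTransp j) (pos i) = γ (pos i) :=
    fun γ => by simp [simpleTransp, hq, Equiv.swap_apply_of_ne_of_ne d1 d2.symm]
  have e7 : ∀ γ : Equiv.Perm (Fin n), γ * simpleTransp i * simpleTransp j * simpleTransp i
      = γ * simpleTransp j * simpleTransp i * simpleTransp j := by
    intro γ
    have : simpleTransp i * simpleTransp j * simpleTransp i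
        = simpleTransp j * simpleTransp i * simpleTransp j := by
      refine Equiv.ext fun x => ?_
      simp only [Equiv.Perm.mul_apply, simpleTransp, hq, Equiv.swap_apply_def]
      grind
    simp only [mul_assoc] at this ⊢
    rw [this]
  refine Finsupp.lhom_ext fun γ r => ?_
  simp only [Module.End.mul_apply]
  have hxy := asc_or_desc γ i
  have hyz := asc_or_desc γ j
  have hxz : γ (pos i) < γ (posSucc j) ∨ γ (posSucc j) < γ (pos i) :=
    lt_or_gt_of_ne (fun h => d2 (γ.injective h).symm)
  rw [hq] at hyz
  have fd := fun (γ : Equiv.Perm (Fin n)) r => fullOp_desc c P j γ r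
  have fz := fun (γ : Equiv.Perm (Fin n)) r => fullOp_zero c P j γ r
  have fa := fun (γ : Equiv.Perm (Fin n)) r => fullOp_asc c P j γ r
  rw [hq] at fd fz fa
  by_cases p1 : P.rel (γ (pos i)) (γ (posSucc i)) <;>
  by_cases p2 : P.rel (γ (posSucc i)) (γ (posSucc j)) <;>
  by_cases p3 : P.rel (γ (pos i)) (γ (posSucc j)) <;>
  rcases hxy with hxy | hxy <;> rcases hyz with hyz | hyz <;> rcases hxz with hxz | hxz <;>
  first
  | exact absurd (hxy.trans hyz) (not_lt.mpr hxz.le)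
  | exact absurd (hyz.trans hxy) (not_lt.mpr hxz.le)
  | simp [fullOp_desc c P i, fullOp_zero c P i, fullOp_asc c P i, fd, fz, fa, hxy, hyz, hxz,
      p1, p2, p3, e1, e2, e3, e4, e5, e6, e7, -Equiv.Perm.coe_mul, -Finsupp.single_mul]

/-- The inclusion of `ℂ Σ_R(P)` in the span of all permutations. -/
noncomputable def incl (P : Poset n) : (SigmaR P →₀ ℂ) →ₗ[ℂ] (Equiv.Perm (Fin n) →₀ ℂ) :=
  Finsupp.lmapDomain ℂ ℂ Subtype.val

lemma incl_injective (P : Poset n) : Function.Injective (incl P) :=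
  Finsupp.mapDomain_injective Subtype.val_injective

lemma mul_mem_SigmaR_iff (P : Poset n) (γ : SigmaR P) (i : Fin (n - 1)) :
    γ.val * simpleTransp i ∈ SigmaR P ↔ ¬ P.rel (γ.val (pos i)) (γ.val (posSucc i)) := by
  have hγ := (mem_SigmaR_iff P γ.val).1 γ.2
  rw [mem_SigmaR_iff]
  constructor
  · intro h hr
    have := h (posSucc i) (pos i) (by rw [mul_pos_eq, mul_posSucc_eq]; exact hr)
    exact absurd (pos_lt i) (not_lt.mpr this)
  · intro h k l hr
    have h1 := hγ (simpleTransp i k) (simpleTransp i l) hr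
    by_contra hlt
    rw [not_le] at hlt
    rcases eq_or_ne (l, k) (pos i, posSucc i) with he | he
    · obtain ⟨rfl, rfl⟩ := Prod.mk.inj he
      rw [mul_pos_eq, mul_posSucc_eq] at hr
      exact h hr
    · revert h1
      simp only [simpleTransp, Equiv.swap_apply_def, imp_false, not_le]
      simp only [pos, posSucc, Prod.mk.injEq, Fin.ext_iff, ne_eq, Fin.lt_def] at *
      split_ifs <;> simp_all <;> omega

lemma incl_posetOp (c : ℂ) (P : Poset n) (i : Fin (n - 1)) (x : SigmaR P →₀ ℂ) :
    incl P (posetOp c P i x) = fullOp c P i (incl P x) := by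
  suffices incl P ∘ₗ posetOp c P i = fullOp c P i ∘ₗ incl P from LinearMap.congr_fun this x
  refine Finsupp.lhom_ext fun γ r => ?_
  have hd := mem_desR_iff γ.val i
  have hm := mul_mem_SigmaR_iff P γ i
  simp only [LinearMap.comp_apply, incl, posetOp, Finsupp.lmapDomain_apply,
    Finsupp.mapDomain_single]
  rcases asc_or_desc γ.val i with h | h
  · by_cases h' : P.rel (γ.val (pos i)) (γ.val (posSucc i))
    · rw [fullOp_zero c P i _ r h h']
      simp [hd, hm, h', not_lt.mpr h.le]
    · rw [fullOp_asc c P i _ r h h']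
      simp [hd, hm, h', not_lt.mpr h.le]
  · rw [fullOp_desc c P i _ r h]
    simp [hd, h, -Finsupp.single_mul]

lemma posetOp_quad (c : ℂ) (P : Poset n) (i : Fin (n - 1)) :
    posetOp c P i * posetOp c P i = c • posetOp c P i := by
  refine LinearMap.ext fun x => incl_injective P ?_
  have := LinearMap.congr_fun (fullOp_quad c P i) (incl P x)
  simpa [incl_posetOp] using this

lemma posetOp_comm (c : ℂ) (P : Poset n) (i j : Fin (n - 1))
    (h : i.val + 2 ≤ j.val ∨ j.val + 2 ≤ i.val) :
    posetOp c P i * posetOp c P j = posetOp c P j * posetOp c P i := by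
  refine LinearMap.ext fun x => incl_injective P ?_
  have : fullOp c P i * fullOp c P j = fullOp c P j * fullOp c P i := by
    rcases h with h | h
    · exact fullOp_comm c P i j h
    · exact (fullOp_comm c P j i h).symm
  simpa [incl_posetOp] using LinearMap.congr_fun this (incl P x)

lemma posetOp_braid (c : ℂ) (P : Poset n) (i j : Fin (n - 1)) (h : j.val = i.val + 1) :
    posetOp c P i * posetOp c P j * posetOp c P i
      = posetOp c P j * posetOp c P i * posetOp c P j := by
  refine LinearMap.ext fun x => incl_injective P ?_
  simpa [incl_posetOp] using LinearMap.congr_fun (fullOp_braid c P i j h) (incl P x)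

lemma posetOp_neg (P : Poset n) (i : Fin (n - 1)) :
    posetOp (-1) P i * posetOp (-1) P i = -posetOp (-1) P i := by
  refine LinearMap.ext fun x => ?_
  simp [posetOp_quad]

/-- The action on the poset module: `π̄_i` acts by `posetOp (-1)`. -/
noncomputable def actionM (P : Poset n) : (H n)ᵐᵒᵖ →ₐ[ℂ] Module.End ℂ (SigmaR P →₀ ℂ) :=
  AlgHom.opComm (liftH (fun i => MulOpposite.op (posetOp (-1) P i))
    (fun i => congrArg MulOpposite.op (posetOp_neg P i))
    (fun i j h => by
      simp only [← MulOpposite.op_mul, ← mul_assoc]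
      rw [posetOp_braid _ P i j h])
    (fun i j h => by
      simp only [← MulOpposite.op_mul]
      rw [posetOp_comm _ P i j h]))

lemma sub_one_quad {R : Type*} [Ring R] {x : R} (h : x * x = x) :
    (x - 1) * (x - 1) = -(x - 1) := by
  simp only [mul_sub, sub_mul, h, mul_one, one_mul]
  abel

lemma sub_one_braid {R : Type*} [Ring R] {x y : R} (hx : x * x = x) (hy : y * y = y)
    (h : x * y * x = y * x * y) :
    (x - 1) * (y - 1) * (x - 1) = (y - 1) * (x - 1) * (y - 1) := by
  simp only [mul_sub, sub_mul, h, hx, hy, mul_one, one_mul]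
  abel

lemma sub_one_comm {R : Type*} [Ring R] {x y : R} (h : x * y = y * x) :
    (x - 1) * (y - 1) = (y - 1) * (x - 1) := by
  simp only [mul_sub, sub_mul, h, mul_one, one_mul]
  abel

lemma posetOp_idem (P : Poset n) (i : Fin (n - 1)) :
    posetOp 1 P i * posetOp 1 P i = posetOp 1 P i := by
  rw [posetOp_quad, one_smul]

/-- The action on the modified poset module: `π_i = π̄_i + 1` acts by `posetOp 1`. -/
noncomputable def actionM' (P : Poset n) : (H n)ᵐᵒᵖ →ₐ[ℂ] Module.End ℂ (SigmaR P →₀ ℂ) :=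
  AlgHom.opComm (liftH (fun i => MulOpposite.op (posetOp 1 P i - 1))
    (fun i => by
      exact congrArg MulOpposite.op (sub_one_quad (R := Module.End ℂ (SigmaR P →₀ ℂ))
        (posetOp_idem P i)))
    (fun i j h => by
      simp only [← MulOpposite.op_mul, ← mul_assoc]
      exact congrArg MulOpposite.op
        (sub_one_braid (R := Module.End ℂ (SigmaR P →₀ ℂ))
          (posetOp_idem P i) (posetOp_idem P j) (posetOp_braid 1 P i j h)))
    (fun i j h => by
      simp only [← MulOpposite.op_mul]
      exact congrArg MulOpposite.op (sub_one_comm (R := Module.End ℂ (SigmaR P →₀ ℂ))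
        (posetOp_comm 1 P i j h)).symm))

/-- The poset module `M_P`: the space `ℂ Σ_R(P)` with the right `H_n(0)`-action given by
`γ · π̄_i = -γ` if `i ∈ Des_R(γ)`, `0` if `i ∉ Des_R(γ)` and `γ s_i ∉ Σ_R(P)`, and `γ s_i` if
`i ∉ Des_R(γ)` and `γ s_i ∈ Σ_R(P)`. -/
def M (P : Poset n) : Type := SigmaR P →₀ ℂ

/-- The module `M'_P`: the space `ℂ Σ_R(P)` with the right `H_n(0)`-action given by
`γ · π_i = γ` if `i ∈ Des_R(γ)`, `0` if `i ∉ Des_R(γ)` and `γ s_i ∉ Σ_R(P)`, and `γ s_i` if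
`i ∉ Des_R(γ)` and `γ s_i ∈ Σ_R(P)`. -/
def M' (P : Poset n) : Type := SigmaR P →₀ ℂ

noncomputable instance (P : Poset n) : AddCommGroup (M P) :=
  inferInstanceAs (AddCommGroup (SigmaR P →₀ ℂ))
noncomputable instance (P : Poset n) : Module ℂ (M P) :=
  inferInstanceAs (Module ℂ (SigmaR P →₀ ℂ))
noncomputable instance (P : Poset n) : Module (H n)ᵐᵒᵖ (M P) :=
  Module.compHom (SigmaR P →₀ ℂ) (actionM P).toRingHom

noncomputable instance (P : Poset n) : AddCommGroup (M' P) :=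
  inferInstanceAs (AddCommGroup (SigmaR P →₀ ℂ))
noncomputable instance (P : Poset n) : Module ℂ (M' P) :=
  inferInstanceAs (Module ℂ (SigmaR P →₀ ℂ))
noncomputable instance (P : Poset n) : Module (H n)ᵐᵒᵖ (M' P) :=
  Module.compHom (SigmaR P →₀ ℂ) (actionM' P).toRingHom

/-- The identity of the underlying vector spaces. -/
noncomputable def M.equiv (P : Poset n) : M P ≃ₗ[ℂ] (SigmaR P →₀ ℂ) := LinearEquiv.refl ℂ _

/-- The identity of the underlying vector spaces. -/
noncomputable def M'.equiv (P : Poset n) : M' P ≃ₗ[ℂ] (SigmaR P →₀ ℂ) := LinearEquiv.refl ℂ _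

lemma M.equiv_smul (P : Poset n) (h : (H n)ᵐᵒᵖ) (x : M P) :
    M.equiv P (h • x) = actionM P h (M.equiv P x) := rfl

lemma M'.equiv_smul (P : Poset n) (h : (H n)ᵐᵒᵖ) (x : M' P) :
    M'.equiv P (h • x) = actionM' P h (M'.equiv P x) := rfl

instance (P : Poset n) : IsScalarTower ℂ (H n)ᵐᵒᵖ (M P) where
  smul_assoc c h x := (M.equiv P).injective (by simp [M.equiv_smul])

instance (P : Poset n) : IsScalarTower ℂ (H n)ᵐᵒᵖ (M' P) where
  smul_assoc c h x := (M'.equiv P).injective (by simp [M'.equiv_smul])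

lemma actionM_opi (P : Poset n) (i : Fin (n - 1)) :
    actionM P (MulOpposite.op (opi i)) = posetOp (-1) P i := by
  simp [actionM, AlgHom.opComm, liftH_opi]

lemma actionM'_ppi (P : Poset n) (i : Fin (n - 1)) :
    actionM' P (MulOpposite.op (ppi i)) = posetOp 1 P i := by
  simp only [ppi, MulOpposite.op_add, MulOpposite.op_one, map_add, map_one]
  simp only [actionM', AlgHom.opComm]
  simp [liftH_opi]
  exact sub_add_cancel (posetOp 1 P i) 1

end PosetModule

end PosetModules

/-! Write w₀ for the reversal of [N] and P₁ ⊔ P₂ for the disjoint union of P₁ with the translate of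
P₂ by m (`Poset.sum`). The corollary follows from two facts.

Twists of one poset module. Conjugation γ ↦ w₀ γ w₀ carries Σ_R(P) onto Σ_R(P̄*) and turns position
i into position N - i, so φ[M_P] ≅ M_{P̄*} (`phiTwistM`). The operator -π̄_i fixes γ at a descent
and gives 0 or -γ s_i at an ascent; rescaling γ by its sign removes the minus sign, so θ[M_P] ≅ M'_P
(`thetaTwistM`). Transposing π_i on M_P and relabelling the functional dual to γ by w₀ γ exchanges
ascents with descents and yields the rule of M'_{P̄}, so χ[M_P] ≅ M'_{P̄} (`chiTwistM`).

Induction products. M_{P₁} ⊠ M_{P₂} ≅ M_{P₁ ⊔ P₂}, and likewise for M' (`indProdEquiv`). The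
equivariant map γ₁ ⊗ γ₂ ↦ γ₁ ⊕ γ₂ extends to the induced module by Frobenius reciprocity. The
induced module is spanned by the (γ₁ ⊗ γ₂) ⊗ g_w with w a shuffle (`span_shuffleFamily`), and these
go to the permutations (γ₁ ⊕ γ₂) w, which are pairwise distinct and hence linearly independent. This
gives injectivity without a basis of the Hecke algebra. Surjectivity is an induction on length: an
element of Σ_R(P₁ ⊔ P₂) either has a letter of the second block just before one of the first, and is
then reached from a shorter element, or is a block permutation. Both kinds of module are treated at
once: g is π̄ with g² = -g, or π with g² = g.

For (a), replace the product by the module of P₁ ⊔ P₂, twist it, and split again; the bar exchanges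
the two blocks (`Poset.sum_bar`), which accounts for the reversed order of the factors. For (b),
twisting commutes with restriction because the restricted maps are compatible with φ, θ, χ, so only
the first fact is needed. -/

namespace PosetModules

/-! ### Equivariance of linear maps -/

section Equivariance

variable {A B : Type*} [Ring A] [Algebra ℂ A] [Ring B] [Algebra ℂ B]

/-- A linear map that intertwines the actions of algebra generators, along a homomorphism,
intertwines the actions of the whole algebra. -/
lemma equivariant_of_adjoin {s : Set A} (hs : Algebra.adjoin ℂ s = ⊤) (f : A →ₐ[ℂ] B)
    {V W : Type*} [AddCommGroup V] [Module ℂ V] [Module Aᵐᵒᵖ V] [IsScalarTower ℂ Aᵐᵒᵖ V]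
    [AddCommGroup W] [Module ℂ W] [Module Bᵐᵒᵖ W] [IsScalarTower ℂ Bᵐᵒᵖ W] (e : V →ₗ[ℂ] W)
    (he : ∀ a ∈ s, ∀ v, e (MulOpposite.op a • v) = MulOpposite.op (f a) • e v) (a : A) (v : V) :
    e (MulOpposite.op a • v) = MulOpposite.op (f a) • e v := by
  have ha : a ∈ Algebra.adjoin ℂ s := by rw [hs]; trivial
  induction ha using Algebra.adjoin_induction generalizing v with
  | mem x hx => exact he x hx v
  | algebraMap r =>
    rw [AlgHom.commutes, Algebra.algebraMap_eq_smul_one, Algebra.algebraMap_eq_smul_one,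
      MulOpposite.op_smul, MulOpposite.op_smul, smul_assoc, smul_assoc, MulOpposite.op_one,
      MulOpposite.op_one, one_smul, one_smul, map_smul]
  | add x y _ _ hx hy =>
    rw [map_add, MulOpposite.op_add, MulOpposite.op_add, add_smul, add_smul, map_add, hx, hy]
  | mul x y _ _ hx hy =>
    rw [map_mul, MulOpposite.op_mul, MulOpposite.op_mul, mul_smul, mul_smul, hy, hx]

/-- A linear isomorphism of right modules that intertwines the actions of algebra generators. -/
def equivOfAdjoin {s : Set A} (hs : Algebra.adjoin ℂ s = ⊤)
    {V W : Type*} [AddCommGroup V] [Module ℂ V] [Module Aᵐᵒᵖ V] [IsScalarTower ℂ Aᵐᵒᵖ V]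
    [AddCommGroup W] [Module ℂ W] [Module Aᵐᵒᵖ W] [IsScalarTower ℂ Aᵐᵒᵖ W] (e : V ≃ₗ[ℂ] W)
    (he : ∀ a ∈ s, ∀ v, e (MulOpposite.op a • v) = MulOpposite.op a • e v) : V ≃ₗ[Aᵐᵒᵖ] W :=
  { e with
    map_smul' := fun a v =>
      equivariant_of_adjoin hs (AlgHom.id ℂ A) (e : V →ₗ[ℂ] W) he a.unop v }

/-- A twist of isomorphic modules. -/
def Res.congr (f : A →ₐ[ℂ] B) {V W : Type*} [AddCommGroup V] [Module Bᵐᵒᵖ V]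
    [AddCommGroup W] [Module Bᵐᵒᵖ W] (e : V ≃ₗ[Bᵐᵒᵖ] W) : Res f V ≃ₗ[Aᵐᵒᵖ] Res f W :=
  { e.toAddEquiv with
    map_smul' := fun a v => e.map_smul (AlgHom.op f a) v }

/-- The `ℂ`-linear isomorphism underlying an isomorphism of right modules. -/
def restrictScalarsEquiv {V W : Type*} [AddCommGroup V] [Module ℂ V] [Module Aᵐᵒᵖ V]
    [IsScalarTower ℂ Aᵐᵒᵖ V] [AddCommGroup W] [Module ℂ W] [Module Aᵐᵒᵖ W]
    [IsScalarTower ℂ Aᵐᵒᵖ W] (e : V ≃ₗ[Aᵐᵒᵖ] W) : V ≃ₗ[ℂ] W :=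
  { e.toAddEquiv with
    map_smul' := fun c v => by
      -- A scalar c acts as the algebra element c • 1, by the scalar tower condition on both sides.
      have := e.map_smul (c • (1 : Aᵐᵒᵖ)) v
      rw [smul_assoc, smul_assoc, one_smul, one_smul] at this
      exact this }

/-- The dual twists of isomorphic modules. -/
def DualTwist.congr (ν : A ≃ₐ[ℂ] Aᵐᵒᵖ) {V W : Type*} [AddCommGroup V] [Module ℂ V]
    [Module Aᵐᵒᵖ V] [IsScalarTower ℂ Aᵐᵒᵖ V] [AddCommGroup W] [Module ℂ W] [Module Aᵐᵒᵖ W]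
    [IsScalarTower ℂ Aᵐᵒᵖ W] (e : V ≃ₗ[Aᵐᵒᵖ] W) : DualTwist ν V ≃ₗ[Aᵐᵒᵖ] DualTwist ν W :=
  { ((restrictScalarsEquiv e).symm.dualMap : Module.Dual ℂ V ≃ₗ[ℂ] Module.Dual ℂ W).toAddEquiv with
    map_smul' := fun a δ => by
      refine DualTwist.ext ν W fun w => ?_
      exact congrArg (DualTwist.equiv ν V δ) (e.symm.map_smul (ν a.unop) w).symm }

end Equivariance

/-- The action on M'_P is prescribed on the π_i, so equivariance of maps into or out of it is tested
on these generators. -/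
lemma adjoin_ppi {n : ℕ} : Algebra.adjoin ℂ (Set.range (ppi (n := n))) = ⊤ := by
  rw [eq_top_iff, ← closure_opi]
  refine Algebra.adjoin_le ?_
  rintro _ ⟨i, rfl⟩
  have h : (opi i : H n) = ppi i - 1 := by simp [ppi]
  rw [h]
  exact Subalgebra.sub_mem _ (Algebra.subset_adjoin ⟨i, rfl⟩) (Subalgebra.one_mem _)

/-! ### The twists of a poset module -/

section Twists

variable {n : ℕ}

lemma rev_pos (i : Fin (n - 1)) : (pos i).rev = posSucc i.rev := by
  ext; simp [pos, posSucc, Fin.val_rev]; omega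

lemma rev_posSucc (i : Fin (n - 1)) : (posSucc i).rev = pos i.rev := by
  ext; simp [pos, posSucc, Fin.val_rev]; omega

lemma revPerm_mul_simpleTransp_mul_revPerm (i : Fin (n - 1)) :
    Fin.revPerm * simpleTransp i.rev * Fin.revPerm = simpleTransp i := by
  have h := Equiv.swap_apply_apply (Fin.revPerm (n := n)) (pos i.rev) (posSucc i.rev)
  simp only [Fin.revPerm_apply, rev_pos, rev_posSucc, Fin.rev_rev] at h
  rw [simpleTransp, simpleTransp, Equiv.swap_comm (pos i), h]
  rfl

/-- Conjugation by the reversal maps `Σ_R(P)` onto `Σ_R(P̄*)`. -/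
def conjRev (P : Poset n) : SigmaR P ≃ SigmaR P.bar.star where
  toFun γ := ⟨Fin.revPerm * γ.val * Fin.revPerm, by
    rw [mem_SigmaR_iff]
    intro k l h
    simp only [Poset.star_rel, Poset.bar_rel, Equiv.Perm.mul_apply, Fin.revPerm_apply,
      Fin.rev_rev] at h
    exact Fin.rev_le_rev.1 ((mem_SigmaR_iff P γ.val).1 γ.2 _ _ h)⟩
  invFun γ := ⟨Fin.revPerm * γ.val * Fin.revPerm, by
    rw [mem_SigmaR_iff]
    intro k l h
    refine Fin.rev_le_rev.1 ((mem_SigmaR_iff _ γ.val).1 γ.2 l.rev k.rev ?_)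
    simpa only [Poset.star_rel, Poset.bar_rel, Equiv.Perm.mul_apply, Fin.revPerm_apply] using h⟩
  left_inv γ := by ext; simp
  right_inv γ := by ext; simp

/-- Left multiplication by the reversal maps `Σ_R(P̄)` onto `Σ_R(P)`. -/
def mulRev (P : Poset n) : SigmaR P.bar ≃ SigmaR P where
  toFun γ := ⟨Fin.revPerm * γ.val, by
    rw [mem_SigmaR_iff]
    intro k l h
    exact (mem_SigmaR_iff _ γ.val).1 γ.2 _ _ h⟩
  invFun γ := ⟨Fin.revPerm * γ.val, by
    rw [mem_SigmaR_iff]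
    intro k l h
    simp only [Poset.bar_rel, Equiv.Perm.mul_apply, Fin.revPerm_apply, Fin.rev_rev] at h
    exact (mem_SigmaR_iff _ γ.val).1 γ.2 _ _ h⟩
  left_inv γ := by ext; simp
  right_inv γ := by ext; simp

/-- This and the next two lemmas put the rule in local form: only the letters at positions i and i +
1 matter, through their order as numbers and their relation in P. Every later case analysis is made
on these data. -/
lemma posetOp_desc (c : ℂ) (P : Poset n) (i : Fin (n - 1)) (γ : SigmaR P) (r : ℂ)
    (h : γ.val (posSucc i) < γ.val (pos i)) :
    posetOp c P i (Finsupp.single γ r) = Finsupp.single γ (r * c) := by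
  simp [posetOp, (mem_desR_iff γ.val i).2 h]

lemma posetOp_zero (c : ℂ) (P : Poset n) (i : Fin (n - 1)) (γ : SigmaR P) (r : ℂ)
    (h : γ.val (pos i) < γ.val (posSucc i)) (h' : P.rel (γ.val (pos i)) (γ.val (posSucc i))) :
    posetOp c P i (Finsupp.single γ r) = 0 := by
  simp [posetOp, mem_desR_iff, not_lt.mpr h.le, mul_mem_SigmaR_iff, h']

lemma posetOp_asc (c : ℂ) (P : Poset n) (i : Fin (n - 1)) (γ : SigmaR P) (r : ℂ)
    (h : γ.val (pos i) < γ.val (posSucc i)) (h' : ¬ P.rel (γ.val (pos i)) (γ.val (posSucc i))) :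
    posetOp c P i (Finsupp.single γ r) =
      Finsupp.single ⟨γ.val * simpleTransp i, (mul_mem_SigmaR_iff P γ i).2 h'⟩ r := by
  simp [posetOp, mem_desR_iff, not_lt.mpr h.le, mul_mem_SigmaR_iff, h', -Finsupp.single_mul]

/-- Conjugation by w₀ reverses both positions and letters. The two reversals cancel on descents,
while the order of P is reversed on reversed letters, which is the order of P̄*. -/
lemma conjRev_posetOp (c : ℂ) (P : Poset n) (i : Fin (n - 1)) (x : SigmaR P →₀ ℂ) :
    Finsupp.domLCongr (R := ℂ) (conjRev P) (posetOp c P i.rev x)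
      = posetOp c P.bar.star i (Finsupp.domLCongr (R := ℂ) (conjRev P) x) := by
  suffices (Finsupp.domLCongr (R := ℂ) (conjRev P)).toLinearMap ∘ₗ posetOp c P i.rev
      = posetOp c P.bar.star i ∘ₗ (Finsupp.domLCongr (R := ℂ) (conjRev P)).toLinearMap from
    LinearMap.congr_fun this x
  refine Finsupp.lhom_ext fun γ r => ?_
  have e1 : (conjRev P γ).val (pos i) = (γ.val (posSucc i.rev)).rev := by
    simp [conjRev, rev_pos]
  have e2 : (conjRev P γ).val (posSucc i) = (γ.val (pos i.rev)).rev := by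
    simp [conjRev, rev_posSucc]
  simp only [LinearMap.comp_apply, LinearEquiv.coe_coe, Finsupp.domLCongr_single]
  rcases asc_or_desc γ.val i.rev with h | h
  · have h1 : (conjRev P γ).val (pos i) < (conjRev P γ).val (posSucc i) := by
      rw [e1, e2, Fin.rev_lt_rev]; exact h
    by_cases h' : P.rel (γ.val (pos i.rev)) (γ.val (posSucc i.rev))
    · rw [posetOp_zero _ _ _ _ _ h h', map_zero, posetOp_zero _ _ _ _ _ h1]
      rw [e1, e2, Poset.star_rel, Poset.bar_rel, Fin.rev_rev, Fin.rev_rev]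
      exact h'
    · rw [posetOp_asc _ _ _ _ _ h h', posetOp_asc _ _ _ _ _ h1, Finsupp.domLCongr_single]
      · congr 1
        ext1
        simp only [conjRev, Equiv.coe_fn_mk, ← revPerm_mul_simpleTransp_mul_revPerm i]
        ext x; simp
      · rw [e1, e2, Poset.star_rel, Poset.bar_rel, Fin.rev_rev, Fin.rev_rev]
        exact h'
  · rw [posetOp_desc _ _ _ _ _ h, posetOp_desc _ _ _ _ _ (by rw [e1, e2, Fin.rev_lt_rev]; exact h),
      Finsupp.domLCongr_single]

/-- `φ[M_P] ≅ M_{P̄*}`. -/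
noncomputable def phiTwistM (P : Poset n) : Twist (phi n) (M P) ≃ₗ[(H n)ᵐᵒᵖ] M P.bar.star :=
  equivOfAdjoin closure_opi
    ((Res.equiv _ _).trans ((M.equiv P).trans
      ((Finsupp.domLCongr (R := ℂ) (conjRev P)).trans (M.equiv P.bar.star).symm))) (by
    rintro _ ⟨i, rfl⟩ (x : SigmaR P →₀ ℂ)
    change Finsupp.domLCongr (R := ℂ) (conjRev P) (actionM P (MulOpposite.op (phi n (opi i))) x)
      = actionM P.bar.star (MulOpposite.op (opi i)) (Finsupp.domLCongr (R := ℂ) (conjRev P) x)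
    rw [phi_opi, actionM_opi, actionM_opi]
    exact conjRev_posetOp _ P i x)

/-- The diagonal map `γ ↦ (-1)^{ℓ(γ)} γ`. -/
noncomputable def signMap (P : Poset n) : (SigmaR P →₀ ℂ) →ₗ[ℂ] (SigmaR P →₀ ℂ) :=
  Finsupp.lsum ℂ fun γ => ((Equiv.Perm.sign γ.val : ℤ) : ℂ) • Finsupp.lsingle γ

lemma signMap_single (P : Poset n) (γ : SigmaR P) (r : ℂ) :
    signMap P (Finsupp.single γ r) = Finsupp.single γ (((Equiv.Perm.sign γ.val : ℤ) : ℂ) * r) := by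
  simp [signMap]

lemma signMap_involutive (P : Poset n) : Function.Involutive (signMap P) := by
  intro x
  suffices signMap P ∘ₗ signMap P = LinearMap.id from LinearMap.congr_fun this x
  refine Finsupp.lhom_ext fun γ r => ?_
  rw [LinearMap.comp_apply, signMap_single, signMap_single, ← mul_assoc, ← Int.cast_mul,
    ← Units.val_mul, Int.units_mul_self]
  simp

/-- The diagonal entries at descents are unaffected by a diagonal rescaling and already agree, since
-(-1) = 1. The off-diagonal entries -1 from γ to γ s_i become 1 because multiplication by s_i
changes the sign. -/
lemma signMap_posetOp (P : Poset n) (i : Fin (n - 1)) (x : SigmaR P →₀ ℂ) :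
    signMap P (-posetOp (-1) P i x) = posetOp 1 P i (signMap P x) := by
  suffices signMap P ∘ₗ (-posetOp (-1) P i) = posetOp 1 P i ∘ₗ signMap P from
    LinearMap.congr_fun this x
  refine Finsupp.lhom_ext fun γ r => ?_
  rw [LinearMap.comp_apply, LinearMap.comp_apply, LinearMap.neg_apply, signMap_single]
  rcases asc_or_desc γ.val i with h | h
  · by_cases h' : P.rel (γ.val (pos i)) (γ.val (posSucc i))
    · rw [posetOp_zero _ _ _ _ _ h h', posetOp_zero _ _ _ _ _ h h', neg_zero, map_zero]
    · have hs : Equiv.Perm.sign (γ.val * simpleTransp i) = -Equiv.Perm.sign γ.val := by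
        rw [Equiv.Perm.sign_mul, simpleTransp, Equiv.Perm.sign_swap (pos_lt i).ne, mul_neg_one]
      rw [posetOp_asc _ _ _ _ _ h h', posetOp_asc _ _ _ _ _ h h', map_neg, signMap_single, hs]
      simp [← Finsupp.single_neg, -Finsupp.single_mul]
  · rw [posetOp_desc _ _ _ _ _ h, posetOp_desc _ _ _ _ _ h, map_neg, signMap_single]
    simp

lemma theta_ppi (i : Fin (n - 1)) : theta n (ppi i) = -opi i := by
  rw [ppi, map_add, map_one, theta_opi, ppi]; abel

/-- `θ[M_P] ≅ M'_P`. -/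
noncomputable def thetaTwistM (P : Poset n) : Twist (theta n) (M P) ≃ₗ[(H n)ᵐᵒᵖ] M' P :=
  -- Tested on π_i, for which θ(π_i) = -π̄_i.
  equivOfAdjoin adjoin_ppi
    ((Res.equiv _ _).trans ((M.equiv P).trans
      ((LinearEquiv.ofInvolutive (signMap P) (signMap_involutive P)).trans (M'.equiv P).symm))) (by
    rintro _ ⟨i, rfl⟩ (x : SigmaR P →₀ ℂ)
    change signMap P (actionM P (MulOpposite.op (theta n (ppi i))) x)
      = actionM' P (MulOpposite.op (ppi i)) (signMap P x)
    rw [theta_ppi, MulOpposite.op_neg, map_neg, actionM_opi, actionM'_ppi]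
    exact signMap_posetOp P i x)

open Classical in
/-- The linear isomorphism from `ℂ Σ_R(P̄)` to the dual of `ℂ Σ_R(P)` that sends `γ` to the
functional dual to the basis element `rev ∘ γ`. -/
noncomputable def dualRev (P : Poset n) : (SigmaR P.bar →₀ ℂ) ≃ₗ[ℂ] Module.Dual ℂ (SigmaR P →₀ ℂ) :=
  (Finsupp.domLCongr (R := ℂ) (mulRev P)).trans
    (Finsupp.basisSingleOne (R := ℂ) (ι := SigmaR P)).toDualEquiv

open Classical in
lemma dualRev_single (P : Poset n) (γ : SigmaR P.bar) (r : ℂ) (δ : SigmaR P) (s : ℂ) :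
    dualRev P (Finsupp.single γ r) (Finsupp.single δ s) = if mulRev P γ = δ then r * s else 0 := by
  have h1 : (Finsupp.single (mulRev P γ) r : SigmaR P →₀ ℂ) =
      r • Finsupp.basisSingleOne (R := ℂ) (ι := SigmaR P) (mulRev P γ) := by simp
  have h2 : (Finsupp.single δ s : SigmaR P →₀ ℂ) =
      s • Finsupp.basisSingleOne (R := ℂ) (ι := SigmaR P) δ := by simp
  rw [dualRev, LinearEquiv.trans_apply, Finsupp.domLCongr_single, Module.Basis.toDualEquiv_apply,
    h1, h2, map_smul, map_smul, LinearMap.smul_apply, Module.Basis.toDual_apply]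
  split_ifs <;> simp [mul_comm]

/-- On M_P the operator π_i = π̄_i + 1 sends γ to 0 at a descent, and at an ascent to γ or γ + γ
s_i. Its transpose therefore fixes δ* when i is an ascent of δ, and sends δ* to (δ s_i)* or 0 when
it is a descent. Since w₀ exchanges ascents and descents, this is the rule of M' on w₀ δ. The proof
compares matrix entries at a pair (γ, δ). -/
lemma dualRev_posetOp (P : Poset n) (i : Fin (n - 1)) (x : SigmaR P.bar →₀ ℂ)
    (y : SigmaR P →₀ ℂ) :
    dualRev P (posetOp 1 P.bar i x) y = dualRev P x (posetOp (-1) P i y + y) := by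
  classical
  suffices (dualRev P).toLinearMap ∘ₗ posetOp 1 P.bar i
      = (LinearMap.lcomp ℂ ℂ (posetOp (-1) P i + LinearMap.id)) ∘ₗ (dualRev P).toLinearMap from
    LinearMap.congr_fun (LinearMap.congr_fun this x) y
  refine Finsupp.lhom_ext fun γ r => Finsupp.lhom_ext fun δ s => ?_
  -- From here on γ lies in Σ_R(P), and the basis element of the left-hand module is w₀ γ; ascents
  -- of γ are descents of w₀ γ.
  obtain ⟨γ, rfl⟩ := (mulRev P).symm.surjective γ
  have hγ := (mem_SigmaR_iff P γ.val).1 γ.2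
  have hδ := (mem_SigmaR_iff P δ.val).1 δ.2
  have e : ∀ k, ((mulRev P).symm γ).val k = (γ.val k).rev := fun k => rfl
  have key : ∀ h, mulRev P ⟨((mulRev P).symm γ).val * simpleTransp i, h⟩ = δ ↔
      γ.val * simpleTransp i = δ.val := by
    intro h
    rw [Subtype.ext_iff]
    change Fin.revPerm * (Fin.revPerm * γ.val * simpleTransp i) = δ.val ↔ _
    rw [← mul_assoc, ← mul_assoc]
    have : (Fin.revPerm * Fin.revPerm : Equiv.Perm (Fin n)) = 1 := by ext; simp
    rw [this, one_mul]
  have key2 : γ.val * simpleTransp i = δ.val ↔ γ.val = δ.val * simpleTransp i := by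
    constructor <;> intro h
    · rw [← h, mul_assoc, simpleTransp_mul_self, mul_one]
    · rw [h, mul_assoc, simpleTransp_mul_self, mul_one]
  simp only [LinearMap.comp_apply, LinearEquiv.coe_coe, LinearMap.lcomp_apply, LinearMap.add_apply,
    LinearMap.id_apply, map_add, dualRev_single, Equiv.apply_symm_apply]
  rcases asc_or_desc γ.val i with h | h
  · rw [posetOp_desc _ _ _ _ _ (by rw [e, e, Fin.rev_lt_rev]; exact h), dualRev_single,
      Equiv.apply_symm_apply]
    rcases asc_or_desc δ.val i with g | g
    · by_cases h' : P.rel (δ.val (pos i)) (δ.val (posSucc i))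
      · rw [posetOp_zero _ _ _ _ _ g h']; simp
      · rw [posetOp_asc _ _ _ _ _ g h', dualRev_single, Equiv.apply_symm_apply, mul_one,
          right_eq_add, if_neg]
        -- If δ s_i were γ, then i would be an ascent of both δ and δ s_i.
        rintro rfl
        rw [mul_pos_eq, mul_posSucc_eq] at h
        exact absurd h (not_lt.mpr g.le)
    · have hne : γ ≠ δ := by rintro rfl; exact absurd h (not_lt.mpr g.le)
      rw [posetOp_desc _ _ _ _ _ g, dualRev_single, Equiv.apply_symm_apply]
      simp [hne]
  · have h1 : ((mulRev P).symm γ).val (pos i) < ((mulRev P).symm γ).val (posSucc i) := by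
      rw [e, e, Fin.rev_lt_rev]; exact h
    have hrel : P.bar.rel (((mulRev P).symm γ).val (pos i)) (((mulRev P).symm γ).val (posSucc i)) ↔
        P.rel (γ.val (pos i)) (γ.val (posSucc i)) := by
      rw [e, e, Poset.bar_rel, Fin.rev_rev, Fin.rev_rev]
    have hdesc : ∀ h, mulRev P ⟨((mulRev P).symm γ).val * simpleTransp i, h⟩ = δ →
        δ.val (pos i) < δ.val (posSucc i) := by
      intro h2 h3
      rw [key] at h3
      rw [← h3, mul_pos_eq, mul_posSucc_eq]
      exact h
    rcases asc_or_desc δ.val i with g | g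
    · have hne : γ ≠ δ := by rintro rfl; exact absurd h (not_lt.mpr g.le)
      rw [if_neg hne, add_zero]
      by_cases h2 : P.rel (γ.val (pos i)) (γ.val (posSucc i))
      · rw [posetOp_zero _ _ _ _ _ h1 (hrel.2 h2), map_zero, LinearMap.zero_apply]
        by_cases h' : P.rel (δ.val (pos i)) (δ.val (posSucc i))
        · rw [posetOp_zero _ _ _ _ _ g h', map_zero]
        · rw [posetOp_asc _ _ _ _ _ g h', dualRev_single, Equiv.apply_symm_apply, if_neg]
          -- Here γ = δ s_i has a relation in P between its letters at i and i + 1, so these letters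
          -- occur in the wrong order in δ, which is a linear extension.
          rintro rfl
          rw [mul_pos_eq, mul_posSucc_eq] at h2
          exact absurd (hδ _ _ h2) (not_le.mpr (pos_lt i))
      · rw [posetOp_asc _ _ _ _ _ h1 (fun h => h2 (hrel.1 h)), dualRev_single]
        simp only [key]
        by_cases h' : P.rel (δ.val (pos i)) (δ.val (posSucc i))
        · rw [posetOp_zero _ _ _ _ _ g h', map_zero, if_neg]
          intro h3
          rw [← h3, mul_pos_eq, mul_posSucc_eq] at h'
          exact absurd (hγ _ _ h') (not_le.mpr (pos_lt i))
        · rw [posetOp_asc _ _ _ _ _ g h', dualRev_single, Equiv.apply_symm_apply]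
          simp only [key2, Subtype.ext_iff]
    -- Both γ and δ descend at i. Then π_i kills δ, and on the other side w₀ γ can only move to w₀ γ
    -- s_i, where γ s_i ascends at i and so differs from δ.
    · have h0 : dualRev P (posetOp 1 P.bar i (Finsupp.single ((mulRev P).symm γ) r))
          (Finsupp.single δ s) = 0 := by
        by_cases h2 : P.rel (γ.val (pos i)) (γ.val (posSucc i))
        · rw [posetOp_zero _ _ _ _ _ h1 (hrel.2 h2), map_zero, LinearMap.zero_apply]
        · rw [posetOp_asc _ _ _ _ _ h1 (fun h => h2 (hrel.1 h)), dualRev_single, if_neg]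
          intro h3
          exact absurd (hdesc _ h3) (not_lt.mpr g.le)
      rw [h0, posetOp_desc _ _ _ _ _ g, dualRev_single, Equiv.apply_symm_apply]
      split_ifs <;> simp

lemma chi_ppi (i : Fin (n - 1)) : chi n (ppi i) = MulOpposite.op (ppi i) := by
  rw [ppi, map_add, map_one, chi_opi, MulOpposite.op_add, MulOpposite.op_one]

/-- `χ[M_P] ≅ M'_{P̄}`. -/
noncomputable def chiTwistM (P : Poset n) : DualTwist (chi n) (M P) ≃ₗ[(H n)ᵐᵒᵖ] M' P.bar :=
  -- The isomorphism is built from M'_{P̄} to the dual space and then inverted, so that equivariance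
  -- becomes an equality of functionals.
  (equivOfAdjoin (V := M' P.bar) (W := DualTwist (chi n) (M P)) adjoin_ppi
    ((M'.equiv P.bar).trans ((dualRev P).trans
      ((M.equiv P).dualMap.trans (DualTwist.equiv (chi n) (M P)).symm))) (by
    rintro _ ⟨i, rfl⟩ (x : SigmaR P.bar →₀ ℂ)
    refine DualTwist.ext _ _ fun y => ?_
    rw [DualTwist.smul_apply, chi_ppi]
    change dualRev P (actionM' P.bar (MulOpposite.op (ppi i)) x) y
      = dualRev P x (actionM P (MulOpposite.op (ppi i)) y)
    rw [actionM'_ppi, ppi, MulOpposite.op_add, MulOpposite.op_one, map_add, map_one, actionM_opi]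
    exact dualRev_posetOp P i x y)).symm

end Twists

/-! ### Twists of restrictions -/

section Restriction

variable {A B B' C : Type*} [Ring A] [Algebra ℂ A] [Ring B] [Algebra ℂ B] [Ring B'] [Algebra ℂ B']
  [Ring C] [Algebra ℂ C]

/-- Pullbacks along two factorizations of the same homomorphism agree. -/
def Res.comm (f : A →ₐ[ℂ] B) (g : B →ₐ[ℂ] C) (f' : A →ₐ[ℂ] B') (g' : B' →ₐ[ℂ] C)
    (h : ∀ x, g (f x) = g' (f' x)) (V : Type*) [AddCommGroup V] [Module Cᵐᵒᵖ V] :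
    Res f (Res g V) ≃ₗ[Aᵐᵒᵖ] Res f' (Res g' V) :=
  { AddEquiv.refl V with
    map_smul' := fun a v =>
      congrArg (fun c => (MulOpposite.op c • (show V from v) : V)) (h a.unop) }

/-- A dual twist of a restriction is the restriction of a dual twist. -/
def DualTwist.res (f : A →ₐ[ℂ] B) (ν : A ≃ₐ[ℂ] Aᵐᵒᵖ) (ν' : B ≃ₐ[ℂ] Bᵐᵒᵖ)
    (h : ∀ x, f (ν x).unop = (ν' (f x)).unop) (V : Type*) [AddCommGroup V] [Module ℂ V]
    [Module Bᵐᵒᵖ V] [IsScalarTower ℂ Bᵐᵒᵖ V] :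
    DualTwist ν (Res f V) ≃ₗ[Aᵐᵒᵖ] Res f (DualTwist ν' V) :=
  { AddEquiv.refl (Module.Dual ℂ V) with
    map_smul' := fun a δ => by
      refine DualTwist.ext ν' V fun v => ?_
      exact congrArg (fun c => (show Module.Dual ℂ V from δ) (MulOpposite.op c • v)) (h a.unop) }

end Restriction

/-! ### The products of generators along reduced words -/

section ReducedWords

variable {n : ℕ} {R : Type*} [Monoid R] (g : Fin (n - 1) → R)

/-- An adjacent transposition reverses the order of exactly one pair. -/
lemma simpleTransp_lt_simpleTransp (i : Fin (n - 1)) {x y : Fin n} (hxy : x < y)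
    (hne : ¬ (x = pos i ∧ y = posSucc i)) : simpleTransp i x < simpleTransp i y := by
  simp only [simpleTransp, Equiv.swap_apply_def]
  simp only [pos, posSucc, Fin.ext_iff, Fin.lt_def] at *
  split_ifs <;> simp_all <;> omega

lemma simpleTransp_inv (i : Fin (n - 1)) : (simpleTransp i)⁻¹ = simpleTransp i :=
  inv_eq_of_mul_eq_one_left (simpleTransp_mul_self i)

lemma mul_simpleTransp_cancel (w : Equiv.Perm (Fin n)) (i : Fin (n - 1)) :
    w * simpleTransp i * simpleTransp i = w := by
  rw [mul_assoc, simpleTransp_mul_self, mul_one]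

open Classical in
/-- The product of the `g i` along a reduced word of `w`. -/
noncomputable def redProd (w : Equiv.Perm (Fin n)) : R :=
  -- An arbitrary descent is split off on the right; the value 1 is taken only at the identity, the
  -- one permutation without descents.
  if h : ∃ i, w (posSucc i) < w (pos i) then redProd (w * simpleTransp h.choose) * g h.choose else 1
termination_by (invPairs w).card
decreasing_by
  have := card_inv_of_desc w _ h.choose_spec
  omega

lemma redProd_one : redProd g 1 = 1 := by
  rw [redProd, dif_neg]
  rintro ⟨i, hi⟩
  exact absurd (pos_lt i) (not_lt.mpr hi.le)

/-- Matsumoto's theorem: the product does not depend on the descent chosen. By induction on length,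
two descents i and j of w are compared by splitting off the longest element of the subgroup
generated by s_i and s_j, which is s_i s_j or s_i s_j s_i; the commutation or braid relation then
identifies the two products. -/
lemma redProd_of_desc
    (hb : ∀ i j : Fin (n - 1), j.val = i.val + 1 → g i * g j * g i = g j * g i * g j)
    (hc : ∀ i j : Fin (n - 1), i.val + 2 ≤ j.val ∨ j.val + 2 ≤ i.val → g i * g j = g j * g i) : ∀ (k : ℕ) (w : Equiv.Perm (Fin n)), (invPairs w).card = k →
    ∀ i, w (posSucc i) < w (pos i) → redProd g w = redProd g (w * simpleTransp i) * g i := by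
  intro k
  induction k using Nat.strong_induction_on with
  | _ k ih =>
  intro w hw
  have step : ∀ (u : Equiv.Perm (Fin n)) (i j : Fin (n - 1)), u = w * simpleTransp i →
      w (posSucc i) < w (pos i) → u (posSucc j) < u (pos j) →
      redProd g u = redProd g (u * simpleTransp j) * g j := by
    rintro u i j rfl h1 h2
    refine ih _ ?_ _ rfl j h2
    have := card_inv_of_desc w i h1
    omega
  have far : ∀ i j : Fin (n - 1), i.val + 2 ≤ j.val → w (posSucc i) < w (pos i) →
      w (posSucc j) < w (pos j) →
      redProd g (w * simpleTransp i) * g i = redProd g (w * simpleTransp j) * g j := by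
    intro i j hij h1 h2
    have d1 : pos j ≠ pos i := by simp only [pos, ne_eq, Fin.ext_iff]; omega
    have d2 : pos j ≠ posSucc i := by simp only [pos, posSucc, ne_eq, Fin.ext_iff]; omega
    have d3 : posSucc j ≠ pos i := by simp only [pos, posSucc, ne_eq, Fin.ext_iff]; omega
    have d4 : posSucc j ≠ posSucc i := by simp only [posSucc, ne_eq, Fin.ext_iff]; omega
    have e : simpleTransp j * simpleTransp i = simpleTransp i * simpleTransp j := by
      refine Equiv.ext fun x => ?_
      simp only [Equiv.Perm.mul_apply, simpleTransp, Equiv.swap_apply_def]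
      grind
    rw [step _ i j rfl h1 (by
        simpa [simpleTransp, Equiv.swap_apply_of_ne_of_ne, d1, d2, d3, d4] using h2),
      step _ j i rfl h2 (by
        simpa [simpleTransp, Equiv.swap_apply_of_ne_of_ne, d1.symm, d2.symm, d3.symm, d4.symm]
          using h1),
      mul_assoc, mul_assoc _ (g i), hc i j (Or.inl hij), mul_assoc w, mul_assoc w, e]
  have near : ∀ i j : Fin (n - 1), j.val = i.val + 1 → w (posSucc i) < w (pos i) →
      w (posSucc j) < w (pos j) →
      redProd g (w * simpleTransp i) * g i = redProd g (w * simpleTransp j) * g j := by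
    intro i j hij h1 h2
    have hq : pos j = posSucc i := by simp only [pos, posSucc, Fin.ext_iff]; omega
    have d1 : pos i ≠ posSucc i := (pos_lt i).ne
    have d2 : posSucc j ≠ pos i := by simp only [pos, posSucc, ne_eq, Fin.ext_iff]; omega
    have d3 : posSucc j ≠ posSucc i := by simp only [posSucc, ne_eq, Fin.ext_iff]; omega
    have e1 := fun γ : Equiv.Perm (Fin n) => mul_pos_eq γ i
    have e2 := fun γ : Equiv.Perm (Fin n) => mul_posSucc_eq γ i
    have e3 : ∀ γ : Equiv.Perm (Fin n), (γ * simpleTransp i) (posSucc j) = γ (posSucc j) :=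
      fun γ => by simp [simpleTransp, Equiv.swap_apply_of_ne_of_ne d2 d3]
    have e4 : ∀ γ : Equiv.Perm (Fin n), (γ * simpleTransp j) (posSucc i) = γ (posSucc j) :=
      fun γ => by rw [← hq]; exact mul_pos_eq γ j
    have e5 : ∀ γ : Equiv.Perm (Fin n), (γ * simpleTransp j) (posSucc j) = γ (posSucc i) :=
      fun γ => by rw [← hq]; exact mul_posSucc_eq γ j
    have e6 : ∀ γ : Equiv.Perm (Fin n), (γ * simpleTransp j) (pos i) = γ (pos i) :=
      fun γ => by simp [simpleTransp, hq, Equiv.swap_apply_of_ne_of_ne d1 d2.symm]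
    have e7 : simpleTransp i * simpleTransp j * simpleTransp i
        = simpleTransp j * simpleTransp i * simpleTransp j := by
      refine Equiv.ext fun x => ?_
      simp only [Equiv.Perm.mul_apply, simpleTransp, hq, Equiv.swap_apply_def]
      grind
    rw [hq] at h2
    -- Three consecutive letters of w decrease, so three more simple transpositions can be split off
    -- in either order, each lowering the length.
    have h3 := h2.trans h1
    have f1 : (w * simpleTransp i) (posSucc j) < (w * simpleTransp i) (pos j) := by
      rw [hq, e2, e3]; exact h3
    have f2 : (w * simpleTransp j) (posSucc i) < (w * simpleTransp j) (pos i) := by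
      rw [e4, e6]; exact h3
    have c1 := card_inv_of_desc _ _ h1
    have c2 := card_inv_of_desc _ _ f1
    have c3 := card_inv_of_desc w j (by rw [hq]; exact h2)
    have c4 := card_inv_of_desc _ _ f2
    rw [step _ i j rfl h1 f1, step _ j i rfl (by rw [hq]; exact h2) f2,
      ih _ (by omega) (w * simpleTransp i * simpleTransp j) rfl i (by
        rw [e4, e6, e1, e3]; exact h2),
      ih _ (by omega) (w * simpleTransp j * simpleTransp i) rfl j (by
        rw [hq, e2, e3, e5, e6]; exact h1)]
    have e8 : w * simpleTransp i * simpleTransp j * simpleTransp i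
        = w * simpleTransp j * simpleTransp i * simpleTransp j := by
      simp only [mul_assoc] at e7 ⊢
      rw [e7]
    have hb' := hb i j hij
    rw [e8]
    simp only [mul_assoc] at hb' ⊢
    rw [hb']
  intro i hi
  have hex : ∃ i, w (posSucc i) < w (pos i) := ⟨i, hi⟩
  rw [redProd, dif_pos hex]
  have hk := hex.choose_spec
  -- Of the chosen descent only the fact that it is a descent is used.
  generalize hex.choose = k at hk
  rcases lt_trichotomy k.val i.val with hlt | heq | hgt
  · by_cases h2 : i.val = k.val + 1
    · exact near k i h2 hk hi
    · exact far k i (by omega) hk hi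
  · rw [Fin.ext heq]
  · by_cases h2 : k.val = i.val + 1
    · exact (near i k h2 hi hk).symm
    · exact (far i k (by omega) hi hk).symm

lemma redProd_mul_of_asc
    (hb : ∀ i j : Fin (n - 1), j.val = i.val + 1 → g i * g j * g i = g j * g i * g j)
    (hc : ∀ i j : Fin (n - 1), i.val + 2 ≤ j.val ∨ j.val + 2 ≤ i.val → g i * g j = g j * g i)
    (w : Equiv.Perm (Fin n)) (i : Fin (n - 1))
    (h : w (pos i) < w (posSucc i)) : redProd g (w * simpleTransp i) = redProd g w * g i := by
  rw [redProd_of_desc g hb hc _ (w * simpleTransp i) rfl i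
    (by rw [mul_pos_eq, mul_posSucc_eq]; exact h), mul_simpleTransp_cancel]

/-- The left-handed counterpart of `redProd_mul_of_asc`, needed because `redProd` is built from the
right. By induction on length, a right descent i of w is split off; s_j w and w still descend
together at i, since the letters exchanged by s_j occur in increasing order in w. -/
lemma redProd_simpleTransp_mul
    (hb : ∀ i j : Fin (n - 1), j.val = i.val + 1 → g i * g j * g i = g j * g i * g j)
    (hc : ∀ i j : Fin (n - 1), i.val + 2 ≤ j.val ∨ j.val + 2 ≤ i.val → g i * g j = g j * g i) : ∀ (k : ℕ) (w : Equiv.Perm (Fin n)), (invPairs w).card = k →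
    ∀ j, w⁻¹ (pos j) < w⁻¹ (posSucc j) → redProd g (simpleTransp j * w) = g j * redProd g w := by
  intro k
  induction k with
  | zero =>
    intro w hw j hj
    have h1 : w = 1 := eq_one_of_no_desc w fun i => by
      rcases asc_or_desc w i with h | h
      · exact h
      · have := card_inv_of_desc w i h; omega
    have h2 := redProd_mul_of_asc g hb hc 1 j (pos_lt j)
    rw [one_mul] at h2
    rw [h1, mul_one, h2, redProd_one, one_mul, mul_one]
  | succ k ih =>
    intro w hw j hj
    obtain ⟨i, hi⟩ : ∃ i, w (posSucc i) < w (pos i) := by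
      by_contra hcon
      push Not at hcon
      have h1 := eq_one_of_no_desc w
        (fun i => (asc_or_desc w i).resolve_right (not_lt.mpr (hcon i)))
      have h2 := card_inv_le_word (n := n) []
      simp [← h1, hw] at h2
    have hcard := card_inv_of_desc w i hi
    -- The letters j and j + 1 stand in increasing order in w, so they are not the two letters of
    -- the descent at i.
    have hne : ¬ (w (posSucc i) = pos j ∧ w (pos i) = posSucc j) := by
      rintro ⟨h1, h2⟩
      rw [← h1, ← h2, Equiv.Perm.inv_def, Equiv.symm_apply_apply, Equiv.symm_apply_apply] at hj
      exact absurd (pos_lt i) (not_lt.mpr hj.le)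
    have hu : (w * simpleTransp i)⁻¹ (pos j) < (w * simpleTransp i)⁻¹ (posSucc j) := by
      rw [mul_inv_rev, simpleTransp_inv, Equiv.Perm.mul_apply, Equiv.Perm.mul_apply]
      refine simpleTransp_lt_simpleTransp i hj ?_
      rintro ⟨h1, h2⟩
      rw [Equiv.Perm.inv_eq_iff_eq] at h1 h2
      rw [← h1, ← h2] at hi
      exact absurd (pos_lt j) (not_lt.mpr hi.le)
    have hasc : (simpleTransp j * (w * simpleTransp i)) (pos i)
        < (simpleTransp j * (w * simpleTransp i)) (posSucc i) := by
      rw [Equiv.Perm.mul_apply, Equiv.Perm.mul_apply (simpleTransp j), mul_pos_eq, mul_posSucc_eq]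
      exact simpleTransp_lt_simpleTransp j hi hne
    have h3 := redProd_mul_of_asc g hb hc _ i hasc
    rw [mul_assoc, mul_simpleTransp_cancel] at h3
    rw [h3, ih _ (by omega) j hu, redProd_of_desc g hb hc _ w rfl i hi, mul_assoc]

end ReducedWords

/-! ### Disjoint unions of posets and block permutations -/

section Blocks

variable {a b N : ℕ} (h : a + b = N)

/-- The decomposition of `[a + b]` into `[a]` and the translate of `[b]` by `a`. -/
def blockEquiv : Fin a ⊕ Fin b ≃ Fin N := finSumFinEquiv.trans (finCongr h)

/-- The inclusion of the first block. -/
def blockL (i : Fin a) : Fin N := blockEquiv h (Sum.inl i)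

/-- The inclusion of the second block. -/
def blockR (j : Fin b) : Fin N := blockEquiv h (Sum.inr j)

lemma blockL_val (i : Fin a) : (blockL h i).val = i.val := by simp [blockL, blockEquiv]

lemma blockR_val (j : Fin b) : (blockR h j).val = a + j.val := by simp [blockR, blockEquiv]

lemma blockL_lt_blockL {i j : Fin a} : blockL h i < blockL h j ↔ i < j := by
  rw [Fin.lt_def, Fin.lt_def, blockL_val, blockL_val]

lemma blockR_lt_blockR {i j : Fin b} : blockR h i < blockR h j ↔ i < j := by
  rw [Fin.lt_def, Fin.lt_def, blockR_val, blockR_val, Nat.add_lt_add_iff_left]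

lemma blockL_lt_blockR (i : Fin a) (j : Fin b) : blockL h i < blockR h j := by
  simp only [Fin.lt_def, blockL_val, blockR_val]; omega

lemma block_cases (x : Fin N) : (∃ i, blockL h i = x) ∨ ∃ j, blockR h j = x := by
  obtain ⟨y, rfl⟩ := (blockEquiv h).surjective x
  rcases y with i | j
  · exact Or.inl ⟨i, rfl⟩
  · exact Or.inr ⟨j, rfl⟩

lemma rev_blockL (h' : b + a = N) (i : Fin a) : (blockL h i).rev = blockR h' i.rev := by
  ext; simp only [Fin.val_rev, blockL_val, blockR_val]; omega

lemma rev_blockR (h' : b + a = N) (j : Fin b) : (blockR h j).rev = blockL h' j.rev := by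
  ext; simp only [Fin.val_rev, blockL_val, blockR_val]; omega

/-- The index of the generator of `H_{a+b}(0)` that corresponds to a generator of `H_a(0)`. -/
def genL (i : Fin (a - 1)) : Fin (N - 1) := ⟨i.val, by omega⟩

/-- The index of the generator of `H_{a+b}(0)` that corresponds to a generator of `H_b(0)`. -/
def genR (j : Fin (b - 1)) : Fin (N - 1) := ⟨a + j.val, by omega⟩

lemma pos_genL (i : Fin (a - 1)) : pos (genL h i) = blockL h (pos i) := by
  ext; simp [pos, genL, blockL_val]

lemma posSucc_genL (i : Fin (a - 1)) : posSucc (genL h i) = blockL h (posSucc i) := by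
  ext; simp [posSucc, genL, blockL_val]

lemma pos_genR (i : Fin (b - 1)) : pos (genR h i) = blockR h (pos i) := by
  ext; simp [pos, genR, blockR_val]

lemma posSucc_genR (i : Fin (b - 1)) : posSucc (genR h i) = blockR h (posSucc i) := by
  ext; simp [posSucc, genR, blockR_val]; omega

/-- The disjoint union of a poset on `[a]` and of the translate by `a` of a poset on `[b]`. -/
def Poset.sum (P₁ : Poset a) (P₂ : Poset b) : Poset N :=
  ⟨@PartialOrder.lift (Fin N) (Fin a ⊕ Fin b) (@Sum.instPartialOrder _ _ P₁.order P₂.order)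
    (blockEquiv h).symm (blockEquiv h).symm.injective⟩

variable (P₁ : Poset a) (P₂ : Poset b)

lemma Poset.sum_rel (x y : Fin a ⊕ Fin b) :
    (P₁.sum h P₂).rel (blockEquiv h x) (blockEquiv h y) ↔ Sum.LiftRel P₁.rel P₂.rel x y := by
  change Sum.LiftRel P₁.rel P₂.rel ((blockEquiv h).symm (blockEquiv h x))
    ((blockEquiv h).symm (blockEquiv h y)) ↔ _
  rw [Equiv.symm_apply_apply, Equiv.symm_apply_apply]

lemma Poset.sum_rel_LL (i j : Fin a) :
    (P₁.sum h P₂).rel (blockL h i) (blockL h j) ↔ P₁.rel i j :=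
  (Poset.sum_rel h P₁ P₂ _ _).trans Sum.liftRel_inl_inl

lemma Poset.sum_rel_RR (i j : Fin b) :
    (P₁.sum h P₂).rel (blockR h i) (blockR h j) ↔ P₂.rel i j :=
  (Poset.sum_rel h P₁ P₂ _ _).trans Sum.liftRel_inr_inr

lemma Poset.sum_rel_LR (i : Fin a) (j : Fin b) :
    ¬ (P₁.sum h P₂).rel (blockL h i) (blockR h j) :=
  fun H => Sum.not_liftRel_inl_inr ((Poset.sum_rel h P₁ P₂ _ _).1 H)

lemma Poset.sum_rel_RL (i : Fin b) (j : Fin a) :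
    ¬ (P₁.sum h P₂).rel (blockR h i) (blockL h j) :=
  fun H => Sum.not_liftRel_inr_inl ((Poset.sum_rel h P₁ P₂ _ _).1 H)

lemma Poset.ext_rel {n : ℕ} {P Q : Poset n} (H : ∀ u v, P.rel u v ↔ Q.rel u v) : P = Q := by
  obtain ⟨P⟩ := P
  obtain ⟨Q⟩ := Q
  congr 1
  exact PartialOrder.ext H

/-- The reversal of [a + b] exchanges the two blocks and reverses each of them. -/
lemma Poset.sum_bar (h' : b + a = N) : (P₁.sum h P₂).bar = P₂.bar.sum h' P₁.bar := by
  refine Poset.ext_rel fun u v => ?_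
  rw [Poset.bar_rel]
  rcases block_cases h' u with ⟨i, rfl⟩ | ⟨i, rfl⟩ <;>
  rcases block_cases h' v with ⟨j, rfl⟩ | ⟨j, rfl⟩ <;>
  simp only [rev_blockL h' h, rev_blockR h' h, Poset.sum_rel_LL, Poset.sum_rel_RR,
    Poset.sum_rel_LR, Poset.sum_rel_RL, Poset.bar_rel]

lemma Poset.sum_star : (P₁.sum h P₂).star = P₁.star.sum h P₂.star := by
  refine Poset.ext_rel fun u v => ?_
  rw [Poset.star_rel]
  rcases block_cases h u with ⟨i, rfl⟩ | ⟨i, rfl⟩ <;>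
  rcases block_cases h v with ⟨j, rfl⟩ | ⟨j, rfl⟩ <;>
  simp only [Poset.sum_rel_LL, Poset.sum_rel_RR, Poset.sum_rel_LR, Poset.sum_rel_RL,
    Poset.star_rel]

/-- The permutation of `[a + b]` that acts by `γ₁` and `γ₂` on the two blocks. -/
def blockPerm (γ₁ : Equiv.Perm (Fin a)) (γ₂ : Equiv.Perm (Fin b)) : Equiv.Perm (Fin N) :=
  (blockEquiv h).permCongr (Equiv.Perm.sumCongr γ₁ γ₂)

lemma blockPerm_blockL (γ₁ : Equiv.Perm (Fin a)) (γ₂ : Equiv.Perm (Fin b)) (i : Fin a) :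
    blockPerm h γ₁ γ₂ (blockL h i) = blockL h (γ₁ i) := by
  simp [blockPerm, blockL, Equiv.permCongr_apply]

lemma blockPerm_blockR (γ₁ : Equiv.Perm (Fin a)) (γ₂ : Equiv.Perm (Fin b)) (j : Fin b) :
    blockPerm h γ₁ γ₂ (blockR h j) = blockR h (γ₂ j) := by
  simp [blockPerm, blockR, Equiv.permCongr_apply]

lemma block_ext {σ τ : Equiv.Perm (Fin N)} (hL : ∀ i, σ (blockL h i) = τ (blockL h i))
    (hR : ∀ j, σ (blockR h j) = τ (blockR h j)) : σ = τ := by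
  refine Equiv.ext fun x => ?_
  rcases block_cases h x with ⟨i, rfl⟩ | ⟨j, rfl⟩
  · exact hL i
  · exact hR j

lemma blockL_injective : Function.Injective (blockL (b := b) h) :=
  (blockEquiv h).injective.comp Sum.inl_injective

lemma blockR_injective : Function.Injective (blockR (a := a) h) :=
  (blockEquiv h).injective.comp Sum.inr_injective

lemma simpleTransp_genL (i : Fin (a - 1)) :
    simpleTransp (genL h i) = blockPerm h (simpleTransp i) 1 := by
  refine block_ext h (fun k => ?_) (fun k => ?_)
  · rw [blockPerm_blockL, simpleTransp, simpleTransp, pos_genL, posSucc_genL,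
      (blockL_injective h).swap_apply]
  · rw [blockPerm_blockR, simpleTransp, pos_genL, posSucc_genL, Equiv.swap_apply_of_ne_of_ne]
    · rfl
    · exact (blockL_lt_blockR h _ _).ne'
    · exact (blockL_lt_blockR h _ _).ne'

lemma simpleTransp_genR (i : Fin (b - 1)) :
    simpleTransp (genR h i) = blockPerm h 1 (simpleTransp i) := by
  refine block_ext h (fun k => ?_) (fun k => ?_)
  · rw [blockPerm_blockL, simpleTransp, pos_genR, posSucc_genR, Equiv.swap_apply_of_ne_of_ne]
    · rfl
    · exact (blockL_lt_blockR h _ _).ne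
    · exact (blockL_lt_blockR h _ _).ne
  · rw [blockPerm_blockR, simpleTransp, simpleTransp, pos_genR, posSucc_genR,
      (blockR_injective h).swap_apply]

lemma blockPerm_mul (γ₁ δ₁ : Equiv.Perm (Fin a)) (γ₂ δ₂ : Equiv.Perm (Fin b)) :
    blockPerm h γ₁ γ₂ * blockPerm h δ₁ δ₂ = blockPerm h (γ₁ * δ₁) (γ₂ * δ₂) := by
  refine block_ext h (fun k => ?_) (fun k => ?_) <;>
    simp only [Equiv.Perm.mul_apply, blockPerm_blockL, blockPerm_blockR]

lemma blockPerm_mem_iff (γ₁ : Equiv.Perm (Fin a)) (γ₂ : Equiv.Perm (Fin b)) :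
    blockPerm h γ₁ γ₂ ∈ SigmaR (P₁.sum h P₂) ↔ γ₁ ∈ SigmaR P₁ ∧ γ₂ ∈ SigmaR P₂ := by
  simp only [mem_SigmaR_iff]
  constructor
  · intro H
    refine ⟨fun k l hkl => ?_, fun k l hkl => ?_⟩
    · have := H (blockL h k) (blockL h l)
        (by rw [blockPerm_blockL, blockPerm_blockL, Poset.sum_rel_LL]; exact hkl)
      rwa [← not_lt, blockL_lt_blockL, not_lt] at this
    · have := H (blockR h k) (blockR h l)
        (by rw [blockPerm_blockR, blockPerm_blockR, Poset.sum_rel_RR]; exact hkl)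
      rwa [← not_lt, blockR_lt_blockR, not_lt] at this
  · rintro ⟨H1, H2⟩ k l
    rcases block_cases h k with ⟨i, rfl⟩ | ⟨i, rfl⟩ <;>
    rcases block_cases h l with ⟨j, rfl⟩ | ⟨j, rfl⟩ <;>
    simp only [blockPerm_blockL, blockPerm_blockR, Poset.sum_rel_LL, Poset.sum_rel_RR,
      Poset.sum_rel_LR, Poset.sum_rel_RL, false_imp_iff]
    · rw [← not_lt, blockL_lt_blockL, not_lt]; exact H1 _ _
    · rw [← not_lt, blockR_lt_blockR, not_lt]; exact H2 _ _

variable {P₁ P₂} in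
/-- The block permutation of two elements of `Σ_R(P₁)` and `Σ_R(P₂)`. -/
def blockSigma (γ₁ : SigmaR P₁) (γ₂ : SigmaR P₂) : SigmaR (P₁.sum h P₂) :=
  ⟨blockPerm h γ₁.val γ₂.val, (blockPerm_mem_iff h P₁ P₂ _ _).2 ⟨γ₁.2, γ₂.2⟩⟩

/-- A permutation in whose one-line notation no letter of the second block is immediately followed
by a letter of the first block is a block permutation. -/
lemma exists_blockPerm (γ : Equiv.Perm (Fin N))
    (H : ∀ i : Fin (N - 1), ∀ p q, ¬ (γ (pos i) = blockR h p ∧ γ (posSucc i) = blockL h q)) :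
    ∃ γ₁ γ₂, γ = blockPerm h γ₁ γ₂ := by
  -- Once a letter of the second block has appeared, only letters of that block can follow.
  have up : ∀ d : ℕ, ∀ k l : Fin N, l.val = k.val + d → (∃ p, blockR h p = γ k) →
      ∃ p, blockR h p = γ l := by
    intro d
    induction d with
    | zero =>
      intro k l hkl hk
      rwa [Fin.ext hkl]
    | succ d ih =>
      intro k l hkl hk
      obtain ⟨p, hp⟩ := ih k ⟨k.val + d, by omega⟩ rfl hk
      refine (block_cases h (γ l)).resolve_left ?_
      rintro ⟨q, hq⟩
      refine H ⟨k.val + d, by omega⟩ p q ⟨hp.symm, ?_⟩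
      rw [hq]
      congr 1
      ext
      simp only [posSucc]
      omega
  have hmaps : Set.MapsTo ((blockEquiv h).symm.permCongr γ) (Set.range (Sum.inl : Fin a → _))
      (Set.range (Sum.inl : Fin a → _)) := by
    rintro _ ⟨i, rfl⟩
    rcases block_cases h (γ (blockL h i)) with ⟨j, hj⟩ | hR
    · refine ⟨j, ?_⟩
      rw [Equiv.permCongr_apply, Equiv.symm_symm, Equiv.eq_symm_apply]
      exact hj
    · exfalso
      -- A letter of the second block at a position i among the first a would force all a letters of
      -- the first block into the fewer than a positions before i.
      have hlt : ∀ j : Fin a, (γ⁻¹ (blockL h j)).val < i.val := by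
        intro j
        by_contra hcon
        obtain ⟨p, hp⟩ := up ((γ⁻¹ (blockL h j)).val - i.val) (blockL h i) (γ⁻¹ (blockL h j))
          (by rw [blockL_val]; omega) hR
        rw [Equiv.Perm.inv_def, Equiv.apply_symm_apply] at hp
        exact (blockL_lt_blockR h j p).ne' hp
      have hcard := Fintype.card_le_of_injective
        (fun j : Fin a => (⟨(γ⁻¹ (blockL h j)).val, hlt j⟩ : Fin i.val)) (by
          intro j k hjk
          exact blockL_injective h (γ⁻¹.injective (Fin.ext (Fin.mk.inj hjk))))
      rw [Fintype.card_fin, Fintype.card_fin] at hcard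
      omega
  obtain ⟨⟨γ₁, γ₂⟩, hγ⟩ := Equiv.Perm.mem_sumCongrHom_range_of_perm_mapsTo_inl hmaps
  refine ⟨γ₁, γ₂, ?_⟩
  have h2 : Equiv.Perm.sumCongr γ₁ γ₂ = (blockEquiv h).symm.permCongr γ := hγ
  rw [blockPerm, h2]
  ext x
  simp [Equiv.permCongr_apply]

/-- The shortest representatives of the right cosets of the block permutations. -/
def IsShuffle (w : Equiv.Perm (Fin N)) : Prop :=
  StrictMono (fun i => w⁻¹ (blockL h i)) ∧ StrictMono (fun j => w⁻¹ (blockR h j))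

lemma isShuffle_one : IsShuffle h 1 :=
  ⟨fun _ _ hij => (blockL_lt_blockL h).2 hij, fun _ _ hij => (blockR_lt_blockR h).2 hij⟩

/-- Exchanging the letters at two adjacent positions keeps each block in increasing order when the
two letters come from different blocks. -/
lemma IsShuffle.mul_simpleTransp {w : Equiv.Perm (Fin N)} (hw : IsShuffle h w) (i : Fin (N - 1))
    (hL : ∀ p q, ¬ (blockL h p = w (pos i) ∧ blockL h q = w (posSucc i)))
    (hR : ∀ p q, ¬ (blockR h p = w (pos i) ∧ blockR h q = w (posSucc i))) :
    IsShuffle h (w * simpleTransp i) := by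
  refine ⟨fun p q hpq => ?_, fun p q hpq => ?_⟩ <;>
  simp only [mul_inv_rev, simpleTransp_inv, Equiv.Perm.mul_apply]
  · refine simpleTransp_lt_simpleTransp i (hw.1 hpq) ?_
    rw [Equiv.Perm.inv_eq_iff_eq, Equiv.Perm.inv_eq_iff_eq]
    exact hL p q
  · refine simpleTransp_lt_simpleTransp i (hw.2 hpq) ?_
    rw [Equiv.Perm.inv_eq_iff_eq, Equiv.Perm.inv_eq_iff_eq]
    exact hR p q

/-- Nothing fits between adjacent values, so the arguments are adjacent as well. Applied to the
positions of one block in a shuffle, it shows that neighbouring letters of the same block are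
consecutive numbers. -/
lemma exists_pos_of_strictMono {k : ℕ} {f : Fin k → Fin N} (hf : StrictMono f) (i : Fin (N - 1))
    {p q : Fin k} (hp : f p = pos i) (hq : f q = posSucc i) :
    ∃ j : Fin (k - 1), p = pos j ∧ q = posSucc j := by
  have hpq : p < q := by
    rw [← hf.lt_iff_lt, hp, hq]; exact pos_lt i
  refine ⟨⟨p.val, by omega⟩, rfl, ?_⟩
  by_contra hne
  have h1 : p.val + 1 < q.val := by
    have : q.val ≠ p.val + 1 := fun e => hne (Fin.ext e)
    omega
  have h2 := hf (show p < ⟨p.val + 1, by omega⟩ from Nat.lt_succ_self _)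
  have h3 := hf (show (⟨p.val + 1, by omega⟩ : Fin k) < q from h1)
  rw [hp, Fin.lt_def] at h2
  rw [hq, Fin.lt_def] at h3
  simp only [pos, posSucc] at h2 h3
  omega

lemma perm_eq_one_of_strictMono {k : ℕ} (σ : Equiv.Perm (Fin k)) (hσ : StrictMono σ) : σ = 1 :=
  eq_one_of_no_desc σ fun i => hσ (pos_lt i)

/-- Uniqueness of the permutation that sorts f: the quotient of two such permutations is increasing,
hence the identity. -/
lemma eq_of_strictMono_comp {k : ℕ} {f : Fin k → Fin N} {σ τ : Equiv.Perm (Fin k)}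
    (hσ : StrictMono fun i => f (σ i)) (hτ : StrictMono fun i => f (τ i)) : σ = τ := by
  have h1 : StrictMono (σ⁻¹ * τ : Equiv.Perm (Fin k)) := by
    intro x y hxy
    rw [← hσ.lt_iff_lt]
    simpa using hτ hxy
  exact inv_mul_eq_one.1 (perm_eq_one_of_strictMono _ h1)

/-- The factorization of a permutation as a block permutation times a shuffle is unique. -/
lemma blockPerm_mul_shuffle_injective {γ₁ δ₁ : Equiv.Perm (Fin a)} {γ₂ δ₂ : Equiv.Perm (Fin b)}
    {w u : Equiv.Perm (Fin N)} (hw : IsShuffle h w) (hu : IsShuffle h u)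
    (H : blockPerm h γ₁ γ₂ * w = blockPerm h δ₁ δ₂ * u) : γ₁ = δ₁ ∧ γ₂ = δ₂ ∧ w = u := by
  set σ := blockPerm h γ₁ γ₂ * w with hσ
  -- The shuffle condition now says that γ₁ and γ₂ sort the positions in σ of the letters of the two
  -- blocks, so σ determines them.
  have e1 : w⁻¹ = σ⁻¹ * blockPerm h γ₁ γ₂ := by rw [hσ]; group
  have e2 : u⁻¹ = σ⁻¹ * blockPerm h δ₁ δ₂ := by rw [H]; group
  have hw' := hw
  have hu' := hu
  simp only [IsShuffle, e1, e2, Equiv.Perm.mul_apply, blockPerm_blockL, blockPerm_blockR]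
    at hw' hu'
  have f1 := eq_of_strictMono_comp (f := fun i => σ⁻¹ (blockL h i)) hw'.1 hu'.1
  have f2 := eq_of_strictMono_comp (f := fun i => σ⁻¹ (blockR h i)) hw'.2 hu'.2
  refine ⟨f1, f2, ?_⟩
  subst f1 f2
  exact mul_left_cancel H

end Blocks

/-! ### Frobenius reciprocity -/

section Frobenius

variable {A B : Type*} [Ring A] [Algebra ℂ A] [Ring B] [Algebra ℂ B] (f : A →ₐ[ℂ] B)
  {V X : Type*} [AddCommGroup V] [Module ℂ V] [Module Aᵐᵒᵖ V] [AddCommGroup X] [Module ℂ X]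
  [Module Bᵐᵒᵖ X] [IsScalarTower ℂ Bᵐᵒᵖ X] (j : V →ₗ[ℂ] X)

/-- The map `v ⊗ h ↦ j(v) · h` on `V ⊗_ℂ B`. -/
noncomputable def tensorAction : V ⊗[ℂ] B →ₗ[ℂ] X :=
  TensorProduct.lift (LinearMap.mk₂ ℂ (fun v h => MulOpposite.op h • j v)
    (fun v w h => by rw [map_add, smul_add])
    (fun c v h => by
      rw [map_smul]; exact (Algebra.lsmul ℂ ℂ X (MulOpposite.op h)).map_smul c (j v))
    (fun v h k => by rw [MulOpposite.op_add, add_smul])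
    (fun c v h => by rw [MulOpposite.op_smul, smul_assoc]))

lemma tensorAction_tmul (v : V) (h : B) :
    tensorAction j (v ⊗ₜ[ℂ] h) = MulOpposite.op h • j v := by
  simp [tensorAction]

/-- The linear map `V↑ → X` that corresponds to an equivariant map `V → X↓`. -/
noncomputable def indLift
    (hj : ∀ (a : A) (v : V), j (MulOpposite.op a • v) = MulOpposite.op (f a) • j v) :
    Ind f V →ₗ[ℂ] X :=
  (indRelations f V).liftQ (tensorAction j) (by
    refine Submodule.span_le.2 ?_
    rintro _ ⟨v, a, h, rfl⟩
    change tensorAction j _ = 0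
    rw [map_sub, tensorAction_tmul, tensorAction_tmul, hj, MulOpposite.op_mul, mul_smul, sub_self])

lemma indLift_mk (hj) (v : V) (h : B) :
    indLift f j hj (Ind.mk f V (v ⊗ₜ[ℂ] h)) = MulOpposite.op h • j v :=
  tensorAction_tmul j v h

lemma Ind.induction {p : Ind f V → Prop} (h0 : p 0) (ha : ∀ x y, p x → p y → p (x + y))
    (hm : ∀ (v : V) (h : B), p (Ind.mk f V (v ⊗ₜ[ℂ] h))) (x : Ind f V) : p x := by
  obtain ⟨z, rfl⟩ := Ind.mk_surjective f V x
  induction z using TensorProduct.induction_on with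
  | zero => exact h0
  | tmul v h => exact hm v h
  | add x y hx hy => exact ha _ _ hx hy

lemma indLift_smul (hj) (h : B) (x : Ind f V) :
    indLift f j hj (MulOpposite.op h • x) = MulOpposite.op h • indLift f j hj x := by
  induction x using Ind.induction f with
  | h0 => simp
  | ha x y hx hy => rw [smul_add, map_add, map_add, smul_add, hx, hy]
  | hm v k => rw [Ind.smul_mk, indLift_mk, indLift_mk, MulOpposite.op_mul, mul_smul]

lemma Ind.mk_smul_tmul (a : A) (v : V) (h : B) :
    Ind.mk f V ((MulOpposite.op a • v) ⊗ₜ[ℂ] h) = Ind.mk f V (v ⊗ₜ[ℂ] (f a * h)) :=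
  (Submodule.Quotient.eq _).2 (Submodule.subset_span ⟨v, a, h, rfl⟩)

/-- The linear map `v ↦ v ⊗ h` into `V↑`. -/
noncomputable def indMkLeft (h : B) : V →ₗ[ℂ] Ind f V :=
  (indRelations f V).mkQ ∘ₗ (TensorProduct.mk ℂ V B).flip h

lemma indMkLeft_apply (h : B) (v : V) : indMkLeft f h v = Ind.mk f V (v ⊗ₜ[ℂ] h) := rfl

end Frobenius

/-! ### Induction products of poset modules -/

/-- Compatible families of generators of the 0-Hecke algebras, with `g² = c g`. -/
structure IsHeckeFamily (c : ℂ) (g : ∀ n : ℕ, Fin (n - 1) → H n) : Prop where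
  quad : ∀ n i, g n i * g n i = c • g n i
  braid : ∀ n (i j : Fin (n - 1)), j.val = i.val + 1 →
    g n i * g n j * g n i = g n j * g n i * g n j
  comm : ∀ n (i j : Fin (n - 1)), i.val + 2 ≤ j.val ∨ j.val + 2 ≤ i.val →
    g n i * g n j = g n j * g n i
  left : ∀ {a b N : ℕ} (h : a + b = N) i, embLeft h (g a i) = g N (genL h i)
  right : ∀ {a b N : ℕ} (h : a + b = N) i, embRight h (g b i) = g N (genR h i)
  adjoin : ∀ n, Algebra.adjoin ℂ (Set.range (g n)) = ⊤

lemma isHeckeFamily_opi : IsHeckeFamily (-1) (fun _ i => opi i) where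
  quad n i := by rw [opi_quad, neg_one_smul]
  braid n i j h := opi_braid i j h
  comm n i j h := opi_comm i j h
  left h i := liftH_opi _ _ _ _ _
  right h i := liftH_opi _ _ _ _ _
  adjoin n := closure_opi

lemma ppi_eq_neg_theta {n : ℕ} (i : Fin (n - 1)) : ppi i = -theta n (opi i) := by
  rw [theta_opi, neg_neg]

/-- Since π_i = -θ(π̄_i), the relations are carried over by the automorphism θ; the signs cancel in
the braid and commutation relations and change the constant of the quadratic one from -1 to 1. -/
lemma isHeckeFamily_ppi : IsHeckeFamily 1 (fun _ i => ppi i) where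
  quad n i := by
    rw [ppi_eq_neg_theta, neg_mul_neg, ← map_mul, opi_quad, map_neg, one_smul]
  braid n i j h := by
    simp only [ppi_eq_neg_theta, neg_mul, mul_neg, ← map_mul, opi_braid i j h]
  comm n i j h := by
    simp only [ppi_eq_neg_theta, neg_mul_neg, ← map_mul, opi_comm i j h]
  left h i := by
    rw [ppi, map_add, map_one]
    exact congrArg (· + 1) (liftH_opi _ _ _ _ _)
  right h i := by
    rw [ppi, map_add, map_one]
    exact congrArg (· + 1) (liftH_opi _ _ _ _ _)
  adjoin n := adjoin_ppi

/-- An identification of a right `H_n(0)`-module with `ℂ Σ_R(P)`, on which the generators `g i` act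
by the operators `posetOp c`. -/
structure PosetModel {n : ℕ} (c : ℂ) (g : Fin (n - 1) → H n) (P : Poset n) (X : Type*)
    [AddCommGroup X] [Module ℂ X] [Module (H n)ᵐᵒᵖ X] where
  /-- The underlying linear isomorphism. -/
  equiv : X ≃ₗ[ℂ] (SigmaR P →₀ ℂ)
  equiv_smul : ∀ i x, equiv (MulOpposite.op (g i) • x) = posetOp c P i (equiv x)

/-- `M_P` as a model. -/
noncomputable def modelM {n : ℕ} (P : Poset n) : PosetModel (-1) (fun i => opi i) P (M P) where
  equiv := M.equiv P
  equiv_smul i x := by rw [M.equiv_smul, actionM_opi]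

/-- `M'_P` as a model. -/
noncomputable def modelM' {n : ℕ} (P : Poset n) : PosetModel 1 (fun i => ppi i) P (M' P) where
  equiv := M'.equiv P
  equiv_smul i x := by rw [M'.equiv_smul, actionM'_ppi]

/-! ### The equivariant map on the outer tensor product -/

section InductionProduct

variable {a b N : ℕ} (h : a + b = N) {P₁ : Poset a} {P₂ : Poset b}

/-- The linear map `γ₁ ⊗ γ₂ ↦ γ₁ ⊕ γ₂`. -/
noncomputable def blockMap :
    (SigmaR P₁ →₀ ℂ) ⊗[ℂ] (SigmaR P₂ →₀ ℂ) →ₗ[ℂ] (SigmaR (P₁.sum h P₂) →₀ ℂ) :=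
  Finsupp.lmapDomain ℂ ℂ (fun γ : SigmaR P₁ × SigmaR P₂ => blockSigma h γ.1 γ.2) ∘ₗ
    (finsuppTensorFinsupp' ℂ (SigmaR P₁) (SigmaR P₂)).toLinearMap

lemma blockMap_single (γ₁ : SigmaR P₁) (γ₂ : SigmaR P₂) (r s : ℂ) :
    blockMap h (Finsupp.single γ₁ r ⊗ₜ[ℂ] Finsupp.single γ₂ s)
      = Finsupp.single (blockSigma h γ₁ γ₂) (r * s) := by
  simp [blockMap, -Finsupp.single_mul]

lemma tensor_finsupp_ext {ι κ W : Type*} [AddCommGroup W] [Module ℂ W]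
    {f f' : (ι →₀ ℂ) ⊗[ℂ] (κ →₀ ℂ) →ₗ[ℂ] W}
    (H : ∀ i j r s, f (Finsupp.single i r ⊗ₜ[ℂ] Finsupp.single j s)
      = f' (Finsupp.single i r ⊗ₜ[ℂ] Finsupp.single j s)) : f = f' := by
  refine TensorProduct.ext (Finsupp.lhom_ext fun i r => Finsupp.lhom_ext fun j s => ?_)
  exact H i j r s

/-- At a pair of positions inside the first block, the letters of γ₁ ⊕ γ₂ and their relation in P₁ ⊔
P₂ are those of γ₁, so the same case of the rule applies on both sides. -/
lemma blockMap_posetOp_left (c : ℂ) (i : Fin (a - 1)) (x : SigmaR P₁ →₀ ℂ) (y : SigmaR P₂ →₀ ℂ) :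
    blockMap h (posetOp c P₁ i x ⊗ₜ[ℂ] y)
      = posetOp c (P₁.sum h P₂) (genL h i) (blockMap h (x ⊗ₜ[ℂ] y)) := by
  suffices blockMap h ∘ₗ LinearMap.rTensor (SigmaR P₂ →₀ ℂ) (posetOp c P₁ i)
      = posetOp c (P₁.sum h P₂) (genL h i) ∘ₗ blockMap h from
    LinearMap.congr_fun this (x ⊗ₜ[ℂ] y)
  refine tensor_finsupp_ext fun γ δ r s => ?_
  have e1 : (blockSigma h γ δ).val (pos (genL h i)) = blockL h (γ.val (pos i)) := by
    rw [pos_genL]; exact blockPerm_blockL h _ _ _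
  have e2 : (blockSigma h γ δ).val (posSucc (genL h i)) = blockL h (γ.val (posSucc i)) := by
    rw [posSucc_genL]; exact blockPerm_blockL h _ _ _
  rw [LinearMap.comp_apply, LinearMap.comp_apply, LinearMap.rTensor_tmul, blockMap_single]
  rcases asc_or_desc γ.val i with h1 | h1
  · have h3 : (blockSigma h γ δ).val (pos (genL h i))
        < (blockSigma h γ δ).val (posSucc (genL h i)) := by
      rw [e1, e2, blockL_lt_blockL]; exact h1
    by_cases h2 : P₁.rel (γ.val (pos i)) (γ.val (posSucc i))
    · rw [posetOp_zero _ _ _ _ _ h1 h2, TensorProduct.zero_tmul, map_zero,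
        posetOp_zero _ _ _ _ _ h3 (by rw [e1, e2, Poset.sum_rel_LL]; exact h2)]
    · rw [posetOp_asc _ _ _ _ _ h1 h2, blockMap_single,
        posetOp_asc _ _ _ _ _ h3 (by rw [e1, e2, Poset.sum_rel_LL]; exact h2)]
      congr 1
      ext1
      simp only [blockSigma, simpleTransp_genL, blockPerm_mul, mul_one]
  · rw [posetOp_desc _ _ _ _ _ h1, blockMap_single, posetOp_desc, mul_right_comm]
    rw [e1, e2, blockL_lt_blockL]; exact h1

lemma blockMap_posetOp_right (c : ℂ) (i : Fin (b - 1)) (x : SigmaR P₁ →₀ ℂ)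
    (y : SigmaR P₂ →₀ ℂ) :
    blockMap h (x ⊗ₜ[ℂ] posetOp c P₂ i y)
      = posetOp c (P₁.sum h P₂) (genR h i) (blockMap h (x ⊗ₜ[ℂ] y)) := by
  suffices blockMap h ∘ₗ LinearMap.lTensor (SigmaR P₁ →₀ ℂ) (posetOp c P₂ i)
      = posetOp c (P₁.sum h P₂) (genR h i) ∘ₗ blockMap h from
    LinearMap.congr_fun this (x ⊗ₜ[ℂ] y)
  refine tensor_finsupp_ext fun γ δ r s => ?_
  have e1 : (blockSigma h γ δ).val (pos (genR h i)) = blockR h (δ.val (pos i)) := by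
    rw [pos_genR]; exact blockPerm_blockR h _ _ _
  have e2 : (blockSigma h γ δ).val (posSucc (genR h i)) = blockR h (δ.val (posSucc i)) := by
    rw [posSucc_genR]; exact blockPerm_blockR h _ _ _
  rw [LinearMap.comp_apply, LinearMap.comp_apply, LinearMap.lTensor_tmul, blockMap_single]
  rcases asc_or_desc δ.val i with h1 | h1
  · have h3 : (blockSigma h γ δ).val (pos (genR h i))
        < (blockSigma h γ δ).val (posSucc (genR h i)) := by
      rw [e1, e2, blockR_lt_blockR]; exact h1
    by_cases h2 : P₂.rel (δ.val (pos i)) (δ.val (posSucc i))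
    · rw [posetOp_zero _ _ _ _ _ h1 h2, TensorProduct.tmul_zero, map_zero,
        posetOp_zero _ _ _ _ _ h3 (by rw [e1, e2, Poset.sum_rel_RR]; exact h2)]
    · rw [posetOp_asc _ _ _ _ _ h1 h2, blockMap_single,
        posetOp_asc _ _ _ _ _ h3 (by rw [e1, e2, Poset.sum_rel_RR]; exact h2)]
      congr 1
      ext1
      simp only [blockSigma, simpleTransp_genR, blockPerm_mul, mul_one]
  · rw [posetOp_desc _ _ _ _ _ h1, blockMap_single, posetOp_desc, mul_assoc]
    rw [e1, e2, blockR_lt_blockR]; exact h1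

variable {c : ℂ} {g : ∀ n : ℕ, Fin (n - 1) → H n}

lemma IsHeckeFamily.adjoin_tensor (hg : IsHeckeFamily c g) (a b : ℕ) :
    Algebra.adjoin ℂ ((Set.range fun i => g a i ⊗ₜ[ℂ] (1 : H b)) ∪
      Set.range fun i => (1 : H a) ⊗ₜ[ℂ] g b i) = ⊤ := by
  set S := Algebra.adjoin ℂ ((Set.range fun i => g a i ⊗ₜ[ℂ] (1 : H b)) ∪
      Set.range fun i => (1 : H a) ⊗ₜ[ℂ] g b i) with hS
  have h1 : ∀ x : H a, x ⊗ₜ[ℂ] (1 : H b) ∈ S := by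
    have : (⊤ : Subalgebra ℂ (H a)) ≤
        S.comap (Algebra.TensorProduct.includeLeft : H a →ₐ[ℂ] H a ⊗[ℂ] H b) := by
      rw [← hg.adjoin a]
      refine Algebra.adjoin_le ?_
      rintro _ ⟨i, rfl⟩
      exact Algebra.subset_adjoin (Or.inl ⟨i, rfl⟩)
    exact fun x => this trivial
  have h2 : ∀ y : H b, (1 : H a) ⊗ₜ[ℂ] y ∈ S := by
    have : (⊤ : Subalgebra ℂ (H b)) ≤
        S.comap (Algebra.TensorProduct.includeRight : H b →ₐ[ℂ] H a ⊗[ℂ] H b) := by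
      rw [← hg.adjoin b]
      refine Algebra.adjoin_le ?_
      rintro _ ⟨i, rfl⟩
      exact Algebra.subset_adjoin (Or.inr ⟨i, rfl⟩)
    exact fun y => this trivial
  refine Algebra.eq_top_iff.2 fun z => ?_
  induction z using TensorProduct.induction_on with
  | zero => exact S.zero_mem
  | tmul x y =>
    have := S.mul_mem (h1 x) (h2 y)
    rwa [Algebra.TensorProduct.tmul_mul_tmul, mul_one, one_mul] at this
  | add x y hx hy => exact S.add_mem hx hy

variable {X₁ X₂ X : Type*}
  [AddCommGroup X₁] [Module ℂ X₁] [Module (H a)ᵐᵒᵖ X₁] [IsScalarTower ℂ (H a)ᵐᵒᵖ X₁]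
  [AddCommGroup X₂] [Module ℂ X₂] [Module (H b)ᵐᵒᵖ X₂] [IsScalarTower ℂ (H b)ᵐᵒᵖ X₂]
  [AddCommGroup X] [Module ℂ X] [Module (H N)ᵐᵒᵖ X]
  (E₁ : PosetModel c (g a) P₁ X₁) (E₂ : PosetModel c (g b) P₂ X₂)
  (E : PosetModel c (g N) (P₁.sum h P₂) X)

/-- The identity of the underlying vector spaces. -/
noncomputable def OuterTensor.equiv (A B V W : Type*) [Ring A] [Algebra ℂ A] [Ring B] [Algebra ℂ B]
    [AddCommGroup V] [Module ℂ V] [Module Aᵐᵒᵖ V] [IsScalarTower ℂ Aᵐᵒᵖ V]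
    [AddCommGroup W] [Module ℂ W] [Module Bᵐᵒᵖ W] [IsScalarTower ℂ Bᵐᵒᵖ W] :
    OuterTensor A B V W ≃ₗ[ℂ] V ⊗[ℂ] W := LinearEquiv.refl ℂ _

/-- The map `M_{P₁} ⊗ M_{P₂} → M_{P₁ ⊔ P₂}`, `γ₁ ⊗ γ₂ ↦ γ₁ ⊕ γ₂`. -/
noncomputable def outerMap : OuterTensor (H a) (H b) X₁ X₂ →ₗ[ℂ] X :=
  E.equiv.symm.toLinearMap ∘ₗ blockMap h ∘ₗ
    (TensorProduct.congr E₁.equiv E₂.equiv).toLinearMap ∘ₗ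
      (OuterTensor.equiv (H a) (H b) X₁ X₂).toLinearMap

lemma equiv_outerMap_tmul (x : X₁) (y : X₂) :
    E.equiv (outerMap h E₁ E₂ E (show OuterTensor (H a) (H b) X₁ X₂ from x ⊗ₜ[ℂ] y))
      = blockMap h (E₁.equiv x ⊗ₜ[ℂ] E₂.equiv y) :=
  E.equiv.apply_symm_apply _

lemma outerMap_smul [IsScalarTower ℂ (H N)ᵐᵒᵖ X] (hg : IsHeckeFamily c g) (z : H a ⊗[ℂ] H b)
    (v : OuterTensor (H a) (H b) X₁ X₂) :
    outerMap h E₁ E₂ E (MulOpposite.op z • v) = MulOpposite.op (emb h z) • outerMap h E₁ E₂ E v := by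
  refine equivariant_of_adjoin (hg.adjoin_tensor a b) (emb h) _ ?_ z v
  intro z hz v
  induction (v : X₁ ⊗[ℂ] X₂) using TensorProduct.induction_on with
  | zero =>
    change outerMap h E₁ E₂ E (MulOpposite.op z • 0) = _ • outerMap h E₁ E₂ E 0
    rw [smul_zero, map_zero, smul_zero]
  | add v w hv hw =>
    have e := (outerMap h E₁ E₂ E).map_add (show OuterTensor (H a) (H b) X₁ X₂ from v)
      (show OuterTensor (H a) (H b) X₁ X₂ from w)
    refine (congrArg _ (smul_add (MulOpposite.op z) (show OuterTensor (H a) (H b) X₁ X₂ from v)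
      (show OuterTensor (H a) (H b) X₁ X₂ from w))).trans ?_
    refine ((outerMap h E₁ E₂ E).map_add _ _).trans ?_
    refine Eq.trans ?_ (congrArg _ e.symm)
    rw [smul_add]
    exact congrArg₂ _ hv hw
  | tmul x y =>
    apply E.equiv.injective
    rcases hz with ⟨i, rfl⟩ | ⟨i, rfl⟩
    · rw [emb_tmul, map_one, mul_one, hg.left, E.equiv_smul]
      refine (congrArg _ (congrArg _ (OuterTensor.smul_tmul (H a) (H b) X₁ X₂ _ _ x y))).trans ?_
      rw [equiv_outerMap_tmul, equiv_outerMap_tmul, E₁.equiv_smul, MulOpposite.op_one, one_smul,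
        blockMap_posetOp_left]
    · rw [emb_tmul, map_one, one_mul, hg.right, E.equiv_smul]
      refine (congrArg _ (congrArg _ (OuterTensor.smul_tmul (H a) (H b) X₁ X₂ _ _ x y))).trans ?_
      rw [equiv_outerMap_tmul, equiv_outerMap_tmul, E₂.equiv_smul, MulOpposite.op_one, one_smul,
        blockMap_posetOp_right]

end InductionProduct

/-! ### Bijectivity of the map from the induction product -/

section InductionEquivalence

variable {a b N : ℕ} (h : a + b = N) {P₁ : Poset a} {P₂ : Poset b}
  {c : ℂ} {g : ∀ n : ℕ, Fin (n - 1) → H n}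

lemma IsHeckeFamily.redProd_mul_of_desc (hg : IsHeckeFamily c g) (w : Equiv.Perm (Fin N))
    (i : Fin (N - 1)) (hi : w (posSucc i) < w (pos i)) :
    redProd (g N) w * g N i = c • redProd (g N) w := by
  rw [redProd_of_desc (g N) (hg.braid N) (hg.comm N) _ w rfl i hi, mul_assoc, hg.quad,
    mul_smul_comm]

variable {X₁ X₂ X : Type*}
  [AddCommGroup X₁] [Module ℂ X₁] [Module (H a)ᵐᵒᵖ X₁] [IsScalarTower ℂ (H a)ᵐᵒᵖ X₁]
  [AddCommGroup X₂] [Module ℂ X₂] [Module (H b)ᵐᵒᵖ X₂] [IsScalarTower ℂ (H b)ᵐᵒᵖ X₂]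

variable (X₁ X₂) in
/-- The span of the elements `v ⊗ g_w`, for shuffles `w`. -/
noncomputable def shuffleSpan (g : ∀ n : ℕ, Fin (n - 1) → H n) : Submodule ℂ (IndProd h X₁ X₂) :=
  Submodule.span ℂ {z | ∃ (v : OuterTensor (H a) (H b) X₁ X₂) (w : Equiv.Perm (Fin N)),
    IsShuffle h w ∧ z = Ind.mk _ _ (v ⊗ₜ[ℂ] redProd (g N) w)}

/-- Deodhar's trichotomy for a shuffle w. At a descent, g_w g_i = c g_w. At an ascent either w s_i
is again a shuffle, or w s_i = s_j w with s_j in the block subgroup; then g_w g_i = g_j g_w, and g_j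
passes through the tensor sign to the module. -/
lemma shuffleSpan_mul_gen (hg : IsHeckeFamily c g) (i : Fin (N - 1)) (z : IndProd h X₁ X₂)
    (hz : z ∈ shuffleSpan h X₁ X₂ g) : MulOpposite.op (g N i) • z ∈ shuffleSpan h X₁ X₂ g := by
  have hb := hg.braid N
  have hc := hg.comm N
  induction hz using Submodule.span_induction with
  | zero => rw [smul_zero]; exact Submodule.zero_mem _
  | add x y _ _ hx hy => rw [smul_add]; exact Submodule.add_mem _ hx hy
  | smul r x _ hx =>
    have : MulOpposite.op (g N i) • r • x = r • MulOpposite.op (g N i) • x :=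
      (Algebra.lsmul ℂ ℂ (IndProd h X₁ X₂) (MulOpposite.op (g N i))).map_smul r x
    rw [this]; exact Submodule.smul_mem _ _ hx
  | mem z hz =>
    obtain ⟨v, w, hw, rfl⟩ := hz
    rw [Ind.smul_mk]
    rcases asc_or_desc w i with hi | hi
    · rw [← redProd_mul_of_asc (g N) hb hc w i hi]
      by_cases hL : ∃ p q, blockL h p = w (pos i) ∧ blockL h q = w (posSucc i)
      · obtain ⟨p, q, hp, hq⟩ := hL
        -- Both letters lie in the first block and are adjacent in w, hence consecutive: they are
        -- exchanged by a simple transposition of that block.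
        obtain ⟨j, rfl, rfl⟩ := exists_pos_of_strictMono hw.1 i
          (Equiv.Perm.inv_eq_iff_eq.2 hp) (Equiv.Perm.inv_eq_iff_eq.2 hq)
        have e1 : w * simpleTransp i = simpleTransp (genL h j) * w := by
          rw [simpleTransp, simpleTransp, Equiv.mul_swap_eq_swap_mul, pos_genL, posSucc_genL,
            hp, hq]
        rw [e1, redProd_simpleTransp_mul (g N) hb hc _ w rfl (genL h j)
          (by rw [pos_genL, posSucc_genL]; exact hw.1 (pos_lt j))]
        have e2 : g N (genL h j) = emb h (g a j ⊗ₜ 1) := by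
          rw [emb_tmul, map_one, mul_one, hg.left]
        rw [e2, ← Ind.mk_smul_tmul]
        exact Submodule.subset_span ⟨_, w, hw, rfl⟩
      · by_cases hR : ∃ p q, blockR h p = w (pos i) ∧ blockR h q = w (posSucc i)
        · obtain ⟨p, q, hp, hq⟩ := hR
          obtain ⟨j, rfl, rfl⟩ := exists_pos_of_strictMono hw.2 i
            (Equiv.Perm.inv_eq_iff_eq.2 hp) (Equiv.Perm.inv_eq_iff_eq.2 hq)
          have e1 : w * simpleTransp i = simpleTransp (genR h j) * w := by
            rw [simpleTransp, simpleTransp, Equiv.mul_swap_eq_swap_mul, pos_genR, posSucc_genR,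
              hp, hq]
          rw [e1, redProd_simpleTransp_mul (g N) hb hc _ w rfl (genR h j)
            (by rw [pos_genR, posSucc_genR]; exact hw.2 (pos_lt j))]
          have e2 : g N (genR h j) = emb h (1 ⊗ₜ g b j) := by
            rw [emb_tmul, map_one, one_mul, hg.right]
          rw [e2, ← Ind.mk_smul_tmul]
          exact Submodule.subset_span ⟨_, w, hw, rfl⟩
        · push Not at hL hR
          have hw' := hw.mul_simpleTransp h i
            (fun p q H => hL p q H.1 H.2) (fun p q H => hR p q H.1 H.2)
          exact Submodule.subset_span ⟨v, _, hw', rfl⟩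
    · rw [hg.redProd_mul_of_desc w i hi, TensorProduct.tmul_smul]
      have hz : Ind.mk (emb h) _ (v ⊗ₜ[ℂ] redProd (g N) w) ∈ shuffleSpan h X₁ X₂ g :=
        Submodule.subset_span ⟨v, w, hw, rfl⟩
      exact Submodule.smul_mem _ c hz

lemma shuffleSpan_eq_top (hg : IsHeckeFamily c g) : shuffleSpan h X₁ X₂ g = ⊤ := by
  have stable : ∀ (k : H N) (z : IndProd h X₁ X₂), z ∈ shuffleSpan h X₁ X₂ g →
      MulOpposite.op k • z ∈ shuffleSpan h X₁ X₂ g := by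
    intro k
    have hk : k ∈ Algebra.adjoin ℂ (Set.range (g N)) := by rw [hg.adjoin]; trivial
    induction hk using Algebra.adjoin_induction with
    | mem x hx => obtain ⟨i, rfl⟩ := hx; exact fun z => shuffleSpan_mul_gen h hg i z
    | algebraMap r =>
      intro z hz
      rw [Algebra.algebraMap_eq_smul_one, MulOpposite.op_smul, smul_assoc, MulOpposite.op_one,
        one_smul]
      exact Submodule.smul_mem _ r hz
    | add x y _ _ hx hy =>
      intro z hz
      rw [MulOpposite.op_add, add_smul]
      exact Submodule.add_mem _ (hx z hz) (hy z hz)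
    | mul x y _ _ hx hy =>
      intro z hz
      rw [MulOpposite.op_mul, mul_smul]
      exact hy _ (hx z hz)
  refine Submodule.eq_top_iff'.2 fun z => ?_
  induction z using Ind.induction with
  | h0 => exact Submodule.zero_mem _
  | ha x y hx hy => exact Submodule.add_mem _ hx hy
  | hm v k =>
    -- v ⊗ k is (v ⊗ 1) · k, and 1 is the product attached to the identity, which is a shuffle.
    have e := Ind.smul_mk (emb h) (OuterTensor (H a) (H b) X₁ X₂) k 1 v
    rw [one_mul] at e
    rw [← e]
    exact stable k _ (Submodule.subset_span ⟨v, 1, isShuffle_one h, by rw [redProd_one]⟩)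

variable [AddCommGroup X] [Module ℂ X] [Module (H N)ᵐᵒᵖ X]
  (E₁ : PosetModel c (g a) P₁ X₁) (E₂ : PosetModel c (g b) P₂ X₂)
  (E : PosetModel c (g N) (P₁.sum h P₂) X)

/-- The spanning family `(γ₁ ⊗ γ₂) ⊗ g_w` of the induction product. -/
noncomputable def shuffleFamily (x : SigmaR P₁ × SigmaR P₂ × {w // IsShuffle h w}) :
    IndProd h X₁ X₂ :=
  indMkLeft _ (redProd (g N) x.2.2.val)
    ((OuterTensor.equiv (H a) (H b) X₁ X₂).symm
      (E₁.equiv.symm (Finsupp.single x.1 1) ⊗ₜ[ℂ] E₂.equiv.symm (Finsupp.single x.2.1 1)))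

lemma span_shuffleFamily (hg : IsHeckeFamily c g) :
    Submodule.span ℂ (Set.range (shuffleFamily h E₁ E₂)) = ⊤ := by
  rw [eq_top_iff, ← shuffleSpan_eq_top h hg]
  refine Submodule.span_le.2 ?_
  rintro _ ⟨v, w, hw, rfl⟩
  set S := Submodule.span ℂ (Set.range (shuffleFamily h E₁ E₂)) with hS
  -- Membership in S is vanishing of v ↦ v ⊗ g_w modulo S, a linear condition that can be tested on
  -- tensors of basis elements.
  let q := S.mkQ ∘ₗ indMkLeft (V := OuterTensor (H a) (H b) X₁ X₂) (emb h) (redProd (g N) w)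
  have hq : q ∘ₗ (OuterTensor.equiv (H a) (H b) X₁ X₂).symm.toLinearMap ∘ₗ
      (TensorProduct.congr E₁.equiv E₂.equiv).symm.toLinearMap = 0 := by
    refine tensor_finsupp_ext fun γ₁ γ₂ r s => ?_
    have e1 : (Finsupp.single γ₁ r : SigmaR P₁ →₀ ℂ) = r • Finsupp.single γ₁ 1 := by simp
    have e2 : (Finsupp.single γ₂ s : SigmaR P₂ →₀ ℂ) = s • Finsupp.single γ₂ 1 := by simp
    rw [e1, e2, TensorProduct.smul_tmul_smul, map_smul, map_smul]
    refine congrArg ((r * s) • ·) ?_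
    exact (Submodule.Quotient.mk_eq_zero S).2 (Submodule.subset_span ⟨(γ₁, γ₂, ⟨w, hw⟩), rfl⟩)
  have h0 : q v = 0 := by
    have := LinearMap.congr_fun hq
      ((TensorProduct.congr E₁.equiv E₂.equiv) (OuterTensor.equiv (H a) (H b) X₁ X₂ v))
    simpa using this
  exact (Submodule.Quotient.mk_eq_zero S).1 h0

/-- Along a reduced word of a shuffle, each step exchanges a letter of the first block with a letter
of the second that follows it. These are increasing as numbers and incomparable in P₁ ⊔ P₂, so the
action is always plain multiplication by s_i. Passing to the span of all permutations with `incl`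
avoids carrying membership in Σ_R along the induction. -/
lemma incl_redProd_smul (hg : IsHeckeFamily c g) (γ₁ : Equiv.Perm (Fin a))
    (γ₂ : Equiv.Perm (Fin b)) (x : X)
    (hx : incl _ (E.equiv x) = Finsupp.single (blockPerm h γ₁ γ₂) 1) :
    ∀ (k : ℕ) (w : Equiv.Perm (Fin N)), (invPairs w).card = k → IsShuffle h w →
      incl _ (E.equiv (MulOpposite.op (redProd (g N) w) • x))
        = Finsupp.single (blockPerm h γ₁ γ₂ * w) 1 := by
  intro k
  induction k with
  | zero =>
    intro w hk _
    have h1 : w = 1 := eq_one_of_no_desc w fun i => by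
      rcases asc_or_desc w i with h | h
      · exact h
      · have := card_inv_of_desc w i h; omega
    rw [h1, redProd_one, MulOpposite.op_one, one_smul, mul_one, hx]
  | succ k ih =>
    intro w hk hw
    obtain ⟨i, hi⟩ : ∃ i, w (posSucc i) < w (pos i) := by
      by_contra hcon
      push Not at hcon
      have h1 := eq_one_of_no_desc w
        (fun i => (asc_or_desc w i).resolve_right (not_lt.mpr (hcon i)))
      have h2 := card_inv_le_word (n := N) []
      simp [← h1, hk] at h2
    have hcard := card_inv_of_desc w i hi
    have nL : ∀ p q, ¬ (blockL h p = w (pos i) ∧ blockL h q = w (posSucc i)) := by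
      rintro p q ⟨hp, hq⟩
      rw [← hp, ← hq, blockL_lt_blockL] at hi
      have := hw.1 hi
      simp only [hp, hq, Equiv.Perm.inv_def, Equiv.symm_apply_apply] at this
      exact absurd (pos_lt i) (not_lt.mpr this.le)
    have nR : ∀ p q, ¬ (blockR h p = w (pos i) ∧ blockR h q = w (posSucc i)) := by
      rintro p q ⟨hp, hq⟩
      rw [← hp, ← hq, blockR_lt_blockR] at hi
      have := hw.2 hi
      simp only [hp, hq, Equiv.Perm.inv_def, Equiv.symm_apply_apply] at this
      exact absurd (pos_lt i) (not_lt.mpr this.le)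
    -- A shuffle lists each block increasingly, so the two letters of a descent come from different
    -- blocks, the larger one from the second.
    obtain ⟨p, q, hp, hq⟩ : ∃ p q, blockR h p = w (pos i) ∧ blockL h q = w (posSucc i) := by
      rcases block_cases h (w (pos i)) with ⟨p, hp⟩ | ⟨p, hp⟩ <;>
      rcases block_cases h (w (posSucc i)) with ⟨q, hq⟩ | ⟨q, hq⟩
      · exact absurd ⟨hp, hq⟩ (nL p q)
      · rw [← hp, ← hq] at hi
        exact absurd (blockL_lt_blockR h p q) (not_lt.mpr hi.le)
      · exact ⟨p, q, hp, hq⟩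
      · exact absurd ⟨hp, hq⟩ (nR p q)
    rw [redProd_of_desc (g N) (hg.braid N) (hg.comm N) _ w rfl i hi, MulOpposite.op_mul, mul_smul,
      E.equiv_smul, incl_posetOp, ih _ (by omega) (hw.mul_simpleTransp h i nL nR), fullOp_asc,
      ← mul_assoc, mul_simpleTransp_cancel]
    · rw [Equiv.Perm.mul_apply, Equiv.Perm.mul_apply (blockPerm h γ₁ γ₂), mul_pos_eq,
        mul_posSucc_eq, ← hp, ← hq, blockPerm_blockL, blockPerm_blockR]
      exact blockL_lt_blockR h _ _
    · rw [Equiv.Perm.mul_apply, Equiv.Perm.mul_apply (blockPerm h γ₁ γ₂), mul_pos_eq,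
        mul_posSucc_eq, ← hp, ← hq, blockPerm_blockL, blockPerm_blockR]
      exact Poset.sum_rel_LR h P₁ P₂ _ _

lemma equiv_outerMap_single (γ₁ : SigmaR P₁) (γ₂ : SigmaR P₂) :
    E.equiv (outerMap h E₁ E₂ E ((OuterTensor.equiv (H a) (H b) X₁ X₂).symm
      (E₁.equiv.symm (Finsupp.single γ₁ 1) ⊗ₜ[ℂ] E₂.equiv.symm (Finsupp.single γ₂ 1))))
        = Finsupp.single (blockSigma h γ₁ γ₂) 1 := by
  refine (equiv_outerMap_tmul h E₁ E₂ E _ _).trans ?_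
  rw [LinearEquiv.apply_symm_apply, LinearEquiv.apply_symm_apply, blockMap_single, one_mul]

variable [IsScalarTower ℂ (H N)ᵐᵒᵖ X]

/-- The map `M_{P₁} ⊠ M_{P₂} → M_{P₁ ⊔ P₂}`. -/
noncomputable def indProdMap (hg : IsHeckeFamily c g) : IndProd h X₁ X₂ →ₗ[ℂ] X :=
  indLift (emb h) (outerMap h E₁ E₂ E) (outerMap_smul h E₁ E₂ E hg)

lemma incl_indProdMap_shuffleFamily (hg : IsHeckeFamily c g)
    (x : SigmaR P₁ × SigmaR P₂ × {w // IsShuffle h w}) :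
    incl _ (E.equiv (indProdMap h E₁ E₂ E hg (shuffleFamily h E₁ E₂ x)))
      = Finsupp.single (blockPerm h x.1.val x.2.1.val * x.2.2.val) 1 := by
  rw [shuffleFamily, indMkLeft_apply, indProdMap, indLift_mk]
  refine incl_redProd_smul h E hg _ _ _ ?_ _ _ rfl x.2.2.2
  rw [equiv_outerMap_single]
  simp [incl, blockSigma]

/-- The formal span u of the family maps onto the induction product, and its composite with the map
sends basis elements to distinct permutations. So the composite is injective, and therefore so is
the map itself. -/
lemma indProdMap_injective (hg : IsHeckeFamily c g) :
    Function.Injective (indProdMap h E₁ E₂ E hg) := by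
  let u := Finsupp.linearCombination ℂ (shuffleFamily (g := g) h E₁ E₂)
  have hu : Function.Surjective u := by
    rw [← LinearMap.range_eq_top, Finsupp.range_linearCombination]
    exact span_shuffleFamily h E₁ E₂ hg
  have key : incl _ ∘ₗ E.equiv.toLinearMap ∘ₗ indProdMap h E₁ E₂ E hg ∘ₗ u =
      Finsupp.lmapDomain ℂ ℂ (fun x : SigmaR P₁ × SigmaR P₂ × {w // IsShuffle h w} =>
        blockPerm h x.1.val x.2.1.val * x.2.2.val) := by
    refine Finsupp.lhom_ext fun x r => ?_
    have e : (Finsupp.single x r : _ →₀ ℂ) = r • Finsupp.single x 1 := by simp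
    rw [e, map_smul, map_smul]
    refine congrArg (r • ·) ?_
    simp only [LinearMap.comp_apply, u, Finsupp.linearCombination_single, one_smul,
      LinearEquiv.coe_coe, incl_indProdMap_shuffleFamily, Finsupp.lmapDomain_apply,
      Finsupp.mapDomain_single]
  have hinj : Function.Injective (fun x : SigmaR P₁ × SigmaR P₂ × {w // IsShuffle h w} =>
      blockPerm h x.1.val x.2.1.val * x.2.2.val) := by
    -- Distinctness is the uniqueness of the factorization into a block permutation and a shuffle.
    rintro ⟨⟨γ₁, _⟩, ⟨γ₂, _⟩, ⟨w, hw⟩⟩ ⟨⟨δ₁, _⟩, ⟨δ₂, _⟩, ⟨v, hv⟩⟩ H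
    obtain ⟨rfl, rfl, rfl⟩ := blockPerm_mul_shuffle_injective h hw hv H
    rfl
  intro x y hxy
  obtain ⟨x, rfl⟩ := hu x
  obtain ⟨y, rfl⟩ := hu y
  refine congrArg u (Finsupp.mapDomain_injective hinj ?_)
  have hx := LinearMap.congr_fun key x
  have hy := LinearMap.congr_fun key y
  simp only [LinearMap.comp_apply, Finsupp.lmapDomain_apply] at hx hy
  rw [← hx, ← hy, hxy]

lemma indProdMap_smul (hg : IsHeckeFamily c g) (k : H N) (x : IndProd h X₁ X₂) :
    indProdMap h E₁ E₂ E hg (MulOpposite.op k • x)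
      = MulOpposite.op k • indProdMap h E₁ E₂ E hg x :=
  indLift_smul _ _ _ k x

/-- Letters of different blocks are incomparable in P₁ ⊔ P₂, so a descent from the second block to
the first can be undone inside Σ_R(P₁ ⊔ P₂), and g_i leads back from the shorter permutation.
Without such a descent the permutation is γ₁ ⊕ γ₂, the image of (γ₁ ⊗ γ₂) ⊗ 1. -/
lemma single_mem_range_indProdMap (hg : IsHeckeFamily c g) :
    ∀ (k : ℕ) (γ : SigmaR (P₁.sum h P₂)), (invPairs γ.val).card = k →
      E.equiv.symm (Finsupp.single γ 1) ∈ LinearMap.range (indProdMap h E₁ E₂ E hg) := by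
  intro k
  induction k using Nat.strong_induction_on with
  | _ k ih =>
  intro γ hk
  by_cases hd : ∃ i p q, γ.val (pos i) = blockR h p ∧ γ.val (posSucc i) = blockL h q
  · obtain ⟨i, p, q, hp, hq⟩ := hd
    have hi : γ.val (posSucc i) < γ.val (pos i) := by
      rw [hp, hq]; exact blockL_lt_blockR h q p
    have hmem : γ.val * simpleTransp i ∈ SigmaR (P₁.sum h P₂) := by
      rw [mul_mem_SigmaR_iff, hp, hq]
      exact Poset.sum_rel_RL h P₁ P₂ _ _
    obtain ⟨z, hz⟩ := ih (invPairs (γ.val * simpleTransp i)).card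
      (by have := card_inv_of_desc _ i hi; omega) ⟨γ.val * simpleTransp i, hmem⟩ rfl
    refine ⟨MulOpposite.op (g N i) • z, ?_⟩
    rw [indProdMap_smul, hz, LinearEquiv.eq_symm_apply, E.equiv_smul, LinearEquiv.apply_symm_apply,
      posetOp_asc]
    · congr 1
      ext1
      exact mul_simpleTransp_cancel _ _
    · rw [mul_pos_eq, mul_posSucc_eq]; exact hi
    · rw [mul_pos_eq, mul_posSucc_eq, hp, hq]
      exact Poset.sum_rel_LR h P₁ P₂ _ _
  · push Not at hd
    obtain ⟨γ₁, γ₂, hγ⟩ := exists_blockPerm h γ.val fun i p q hpq => hd i p q hpq.1 hpq.2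
    have hm := γ.2
    rw [hγ, blockPerm_mem_iff] at hm
    obtain rfl : γ = blockSigma h ⟨γ₁, hm.1⟩ ⟨γ₂, hm.2⟩ := Subtype.ext hγ
    refine ⟨Ind.mk _ _ ((OuterTensor.equiv (H a) (H b) X₁ X₂).symm
      (E₁.equiv.symm (Finsupp.single ⟨γ₁, hm.1⟩ 1) ⊗ₜ[ℂ]
        E₂.equiv.symm (Finsupp.single ⟨γ₂, hm.2⟩ 1)) ⊗ₜ[ℂ] 1), ?_⟩
    rw [LinearEquiv.eq_symm_apply, indProdMap, indLift_mk, MulOpposite.op_one, one_smul]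
    exact equiv_outerMap_single h E₁ E₂ E _ _

lemma indProdMap_surjective (hg : IsHeckeFamily c g) :
    Function.Surjective (indProdMap h E₁ E₂ E hg) := by
  intro x
  suffices LinearMap.range (indProdMap h E₁ E₂ E hg) = ⊤ from LinearMap.range_eq_top.1 this x
  refine eq_top_iff.2 fun x _ => ?_
  obtain ⟨y, rfl⟩ := E.equiv.symm.surjective x
  induction y using Finsupp.induction_linear with
  | zero => rw [map_zero]; exact Submodule.zero_mem _
  | add y z hy hz => rw [map_add]; exact Submodule.add_mem _ (hy trivial) (hz trivial)
  | single γ r =>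
    have e : (Finsupp.single γ r : _ →₀ ℂ) = r • Finsupp.single γ 1 := by simp
    rw [e, map_smul]
    exact Submodule.smul_mem _ _ (single_mem_range_indProdMap h E₁ E₂ E hg _ γ rfl)

/-- The induction product of the poset modules of `P₁` and `P₂` is the poset module of their
disjoint union. -/
noncomputable def indProdEquiv (hg : IsHeckeFamily c g) : IndProd h X₁ X₂ ≃ₗ[(H N)ᵐᵒᵖ] X :=
  { LinearEquiv.ofBijective (indProdMap h E₁ E₂ E hg)
      ⟨indProdMap_injective h E₁ E₂ E hg, indProdMap_surjective h E₁ E₂ E hg⟩ with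
    map_smul' := fun k x => indProdMap_smul h E₁ E₂ E hg k.unop x }

end InductionEquivalence

/-! ### The isomorphisms of the corollary -/

section PosetProducts

variable {a b N : ℕ} (h : a + b = N) (P₁ : Poset a) (P₂ : Poset b)

/-- `M_{P₁} ⊠ M_{P₂} ≅ M_{P₁ ⊔ P₂}`. -/
noncomputable def indProdM : IndProd h (M P₁) (M P₂) ≃ₗ[(H N)ᵐᵒᵖ] M (P₁.sum h P₂) :=
  indProdEquiv h (g := fun _ i => opi i) (modelM P₁) (modelM P₂) (modelM (P₁.sum h P₂))
    isHeckeFamily_opi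

/-- `M'_{P₁} ⊠ M'_{P₂} ≅ M'_{P₁ ⊔ P₂}`. -/
noncomputable def indProdM' : IndProd h (M' P₁) (M' P₂) ≃ₗ[(H N)ᵐᵒᵖ] M' (P₁.sum h P₂) :=
  indProdEquiv h (g := fun _ i => ppi i) (modelM' P₁) (modelM' P₂) (modelM' (P₁.sum h P₂))
    isHeckeFamily_ppi

/-- `φ[M_{P₁} ⊠ M_{P₂}] ≅ M_{P̄₂*} ⊠ M_{P̄₁*}`. -/
lemma nonempty_phiTwist_indProd (h' : b + a = N) :
    Nonempty (Twist (phi N) (IndProd h (M P₁) (M P₂)) ≃ₗ[(H N)ᵐᵒᵖ]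
      IndProd h' (M P₂.bar.star) (M P₁.bar.star)) := by
  have e1 := Res.congr (phi N : H N →ₐ[ℂ] H N) (indProdM h P₁ P₂)
  have e2 := phiTwistM (P₁.sum h P₂)
  -- The bar exchanges the blocks and the dual acts on each, so the twisted poset is again a
  -- disjoint union, in the other order.
  rw [Poset.sum_bar h P₁ P₂ h', Poset.sum_star] at e2
  exact ⟨(e1.trans e2).trans (indProdM h' P₂.bar.star P₁.bar.star).symm⟩

/-- `θ[M_{P₁} ⊠ M_{P₂}] ≅ M'_{P₁} ⊠ M'_{P₂}`. -/
lemma nonempty_thetaTwist_indProd :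
    Nonempty (Twist (theta N) (IndProd h (M P₁) (M P₂)) ≃ₗ[(H N)ᵐᵒᵖ]
      IndProd h (M' P₁) (M' P₂)) := by
  have e1 := Res.congr (theta N : H N →ₐ[ℂ] H N) (indProdM h P₁ P₂)
  have e2 := thetaTwistM (P₁.sum h P₂)
  exact ⟨(e1.trans e2).trans (indProdM' h P₁ P₂).symm⟩

/-- `χ[M_{P₁} ⊠ M_{P₂}] ≅ M'_{P̄₂} ⊠ M'_{P̄₁}`. -/
lemma nonempty_chiTwist_indProd (h' : b + a = N) :
    Nonempty (DualTwist (chi N) (IndProd h (M P₁) (M P₂)) ≃ₗ[(H N)ᵐᵒᵖ]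
      IndProd h' (M' P₂.bar) (M' P₁.bar)) := by
  have e1 := DualTwist.congr (chi N) (indProdM h P₁ P₂)
  have e2 := chiTwistM (P₁.sum h P₂)
  rw [Poset.sum_bar h P₁ P₂ h'] at e2
  exact ⟨(e1.trans e2).trans (indProdM' h' P₂.bar P₁.bar).symm⟩

/-- `φ[M_P↓] ≅ M_{P̄*}↓`. -/
lemma nonempty_phiTwist_res (h' : b + a = N) (P : Poset N) :
    Nonempty (Twist (phiRes a b) (Res (emb h') (M P)) ≃ₗ[(H a ⊗[ℂ] H b)ᵐᵒᵖ]
      Res (emb h) (M P.bar.star)) := by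
  -- Twisting the restriction along `phiRes` is restricting the twist along φ: both are pullbacks of
  -- M_P along the same homomorphism.
  have e1 := Res.comm (phiRes a b : H a ⊗[ℂ] H b →ₐ[ℂ] H b ⊗[ℂ] H a) (emb h') (emb h)
    (phi N : H N →ₐ[ℂ] H N) (emb_phiRes h h') (M P)
  have e2 := Res.congr (emb h) (phiTwistM P)
  exact ⟨e1.trans e2⟩

/-- `θ[M_P↓] ≅ M'_P↓`. -/
lemma nonempty_thetaTwist_res (P : Poset N) :
    Nonempty (Twist (thetaRes a b) (Res (emb h) (M P)) ≃ₗ[(H a ⊗[ℂ] H b)ᵐᵒᵖ]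
      Res (emb h) (M' P)) := by
  have e1 := Res.comm (thetaRes a b : H a ⊗[ℂ] H b →ₐ[ℂ] H a ⊗[ℂ] H b) (emb h) (emb h)
    (theta N : H N →ₐ[ℂ] H N) (emb_thetaRes h) (M P)
  have e2 := Res.congr (emb h) (thetaTwistM P)
  exact ⟨e1.trans e2⟩

/-- `χ[M_P↓] ≅ M'_{P̄}↓`. -/
lemma nonempty_chiTwist_res (P : Poset N) :
    Nonempty (DualTwist (chiRes a b) (Res (emb h) (M P)) ≃ₗ[(H a ⊗[ℂ] H b)ᵐᵒᵖ]
      Res (emb h) (M' P.bar)) := by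
  have e1 := DualTwist.res (emb h) (chiRes a b) (chi N) (emb_chiRes h) (M P)
  have e2 := Res.congr (emb h) (chiTwistM P)
  exact ⟨e1.trans e2⟩

end PosetProducts

end PosetModules

theorem mainTheorem10 (m n : ℕ) :
    -- the twists of an induction product, as `H_{m+n}(0)`-modules
    (∀ (P₁ : PosetModules.Poset m) (P₂ : PosetModules.Poset n),
      Nonempty
        (PosetModules.Twist (PosetModules.phi (m + n))
            (PosetModules.IndProd (rfl : m + n = m + n)
              (PosetModules.M P₁) (PosetModules.M P₂))
          ≃ₗ[(PosetModules.H (m + n))ᵐᵒᵖ]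
          PosetModules.IndProd (Nat.add_comm n m)
            (PosetModules.M P₂.bar.star) (PosetModules.M P₁.bar.star)) ∧
      Nonempty
        (PosetModules.Twist (PosetModules.theta (m + n))
            (PosetModules.IndProd (rfl : m + n = m + n)
              (PosetModules.M P₁) (PosetModules.M P₂))
          ≃ₗ[(PosetModules.H (m + n))ᵐᵒᵖ]
          PosetModules.IndProd (rfl : m + n = m + n)
            (PosetModules.M' P₁) (PosetModules.M' P₂)) ∧
      Nonempty
        (PosetModules.DualTwist (PosetModules.chi (m + n))
            (PosetModules.IndProd (rfl : m + n = m + n)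
              (PosetModules.M P₁) (PosetModules.M P₂))
          ≃ₗ[(PosetModules.H (m + n))ᵐᵒᵖ]
          PosetModules.IndProd (Nat.add_comm n m)
            (PosetModules.M' P₂.bar) (PosetModules.M' P₁.bar))) ∧
    -- the twists of a restriction, as `H_m(0) ⊗ H_n(0)`-modules
    (∀ P : PosetModules.Poset (m + n),
      Nonempty
        (PosetModules.Twist (PosetModules.phiRes m n)
            (PosetModules.Res (PosetModules.emb (Nat.add_comm n m)) (PosetModules.M P))
          ≃ₗ[(PosetModules.H m ⊗[ℂ] PosetModules.H n)ᵐᵒᵖ]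
          PosetModules.Res (PosetModules.emb (rfl : m + n = m + n))
            (PosetModules.M P.bar.star)) ∧
      Nonempty
        (PosetModules.Twist (PosetModules.thetaRes m n)
            (PosetModules.Res (PosetModules.emb (rfl : m + n = m + n)) (PosetModules.M P))
          ≃ₗ[(PosetModules.H m ⊗[ℂ] PosetModules.H n)ᵐᵒᵖ]
          PosetModules.Res (PosetModules.emb (rfl : m + n = m + n)) (PosetModules.M' P)) ∧
      Nonempty
        (PosetModules.DualTwist (PosetModules.chiRes m n)
            (PosetModules.Res (PosetModules.emb (rfl : m + n = m + n)) (PosetModules.M P))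
          ≃ₗ[(PosetModules.H m ⊗[ℂ] PosetModules.H n)ᵐᵒᵖ]
          PosetModules.Res (PosetModules.emb (rfl : m + n = m + n))
            (PosetModules.M' P.bar))) := by
  exact ⟨fun P₁ P₂ =>
      ⟨PosetModules.nonempty_phiTwist_indProd _ P₁ P₂ _,
        PosetModules.nonempty_thetaTwist_indProd _ P₁ P₂,
        PosetModules.nonempty_chiTwist_indProd _ P₁ P₂ _⟩,
    fun P =>
      ⟨PosetModules.nonempty_phiTwist_res _ _ P,
        PosetModules.nonempty_thetaTwist_res _ P,
        PosetModules.nonempty_chiTwist_res _ P⟩⟩
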